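/- Fix a dimension $d\ge 1$, $s\in(0,1)$ and $\lambda,\Lambda>0$. For $R>0$ let $B_R(x)=\{y\in\mathbb R^d: |x-y|<R\}$, $B_R=B_R(0)$, $I_R=(-R^{2s},0]$ and $Q_R=B_R\times I_R$. For $\rho\ge 0$ let $\mathcal K_\rho$ be the class of all measurable kernels $K:\mathbb R^d\to[0,\infty)$ such that $$K(y)\ge\lambda\min\{|y|^{-d-2s},\rho^{-d-2s}\}\quad\text{for all } y\in\mathbb R^d\setminus\{0\}$$ (with the convention $\rho^{-d-2s}=\infty$ if $\rho=0$), $$\int_{B_{2r}\setminus B_r}K(y)\,dy\le\Lambda r^{-2s}\quad\text{for all } r>0,$$ and, if $s=1/2$, in addition $\int_{B_{2r}\setminus B_r}yK(y)\,dy=0$ for all $r>0$. Let $$\mathcal M^-_\rho w(x)=\inf_{K\in\mathcal K_\rho}\int_{\mathbb R^d}\delta_yw(x)K(y)\,dy\qquad(\inf\emptyset=+\infty),$$ where $\delta_yw(x)$ is $w(x+y)-w(x)$ if $s<1/2$, $w(x+y)-w(x)-y\cdot\nabla w(x)\mathbf 1_{B_1}(y)$ if $s=1/2$, and $w(x+y)-w(x)-y\cdot\nabla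 w(x)$ if $s>1/2$. For a real number $b$, a function $u\in L^\infty(\mathbb R^d\times I_R)$, defined at every point, with time slices in $L^\infty(\mathbb R^d)$ and lower semicontinuous in $Q_R$, is said to satisfy $\partial_tu-\mathcal M^-_\rho u\ge b$ in $Q_R$ in the viscosity sense if the following holds. Let $(x_0,t_0)\in Q_R$ and $\varepsilon>0$ be such that $B_\varepsilon(x_0)\times(t_0-\varepsilon,t_0]\subseteq Q_R$, and let $\varphi:B_\varepsilon(x_0)\times(t_0-\varepsilon,t_0]\to\mathbb R$ be left-differentiable in time and $C^{1,1}$ in space, with $\varphi(x_0,t_0)=u(x_0,t_0)$ and $\varphi\le u$ in $B_\varepsilon(x_0)\times(t_0-\varepsilon,t_0]$. Then the function $v$ that equals $\varphi$ in $B_\varepsilon(x_0)\times(t_0-\varepsilon,t_0]$ and $u$ elsewhere in $\mathbb R^d\times I_R$ satisfies $\partial_tv(x_0,t_0)-\mathcal M^-_\rho v(x_0,t_0)\ge b$, where $\partial_t$ denotes the left derivative in time. **Theorem.** There is a constant $c>0$ depending only on $d,s,\lambda,\Lambda$ such that the following holds. Let $\rho\ge 0$, $R>\rho$ and $a\ge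 0$, and let $u\in L^\infty(\mathbb R^d\times I_R)$ satisfy $u\ge0$ in $\mathbb R^d\times\overline{I_R}$ and $$\partial_tu-\mathcal M^-_\rho u\ge -R^{-2s}a\quad\text{in } Q_R$$ in the viscosity sense. Then $$\inf_{Q_{R/2}}u\ \ge\ c\int_{I_R\setminus I_{R/2}}\int_{\mathbb R^d}\frac{u(x,t)}{(R+|x|)^{d+2s}}\,dx\,dt-a.$$ -/

import Mathlib

open MeasureTheory Set

namespace NonlocalParabolic

/-- The Euclidean space of dimension `d`. -/
abbrev Space (d : ℕ) : Type := EuclideanSpace ℝ (Fin d)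

/-- The time interval `I_R = (-R^{2s}, 0]`. -/
def timeInterval (s R : ℝ) : Set ℝ := Ioc (-(R ^ (2 * s))) 0

/-- The parabolic cylinder `Q_R = B_R × I_R`. -/
def parabolicCylinder (d : ℕ) (s R : ℝ) : Set (Space d × ℝ) :=
  Metric.ball 0 R ×ˢ timeInterval s R

/-- `min {|y|^{-d-2s}, ρ^{-d-2s}}` for `y ≠ 0`, with the convention `ρ^{-d-2s} = ∞` if `ρ = 0`. -/
noncomputable def truncatedKernel (d : ℕ) (s ρ : ℝ) (y : Space d) : ℝ :=
  if ρ = 0 then ‖y‖ ^ (-(d : ℝ) - 2 * s)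
  else min (‖y‖ ^ (-(d : ℝ) - 2 * s)) (ρ ^ (-(d : ℝ) - 2 * s))

/-- The class of admissible kernels `K : ℝ^d → [0, ∞)`. -/
structure IsAdmissibleKernel {d : ℕ} (s lam Lam ρ : ℝ) (K : Space d → ℝ) : Prop where
  aemeasurable : AEMeasurable K volume
  nonneg : ∀ y, 0 ≤ K y
  lower_bound : ∀ y, y ≠ 0 → lam * truncatedKernel d s ρ y ≤ K y
  upper_bound : ∀ r : ℝ, 0 < r →
    ∫⁻ y in Metric.ball (0 : Space d) (2 * r) \ Metric.ball 0 r, ENNReal.ofReal (K y)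
      ≤ ENNReal.ofReal (Lam * r ^ (-(2 * s)))
  cancellation : s = 1 / 2 → ∀ r : ℝ, 0 < r →
    ∫ y in Metric.ball (0 : Space d) (2 * r) \ Metric.ball 0 r, K y • y = 0

/-- The difference operator `δ_y w(x)`; here `fderiv ℝ w x y` is `y · ∇w(x)`. -/
noncomputable def delta {d : ℕ} (s : ℝ) (w : Space d → ℝ) (x y : Space d) : ℝ :=
  if s < 1 / 2 then w (x + y) - w x
  else if s = 1 / 2 then
    w (x + y) - w x - (Metric.ball (0 : Space d) 1).indicator (fun z => fderiv ℝ w x z) y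
  else w (x + y) - w x - fderiv ℝ w x y

/-- The integro-differential operator `L_K w(x) = ∫ δ_y w(x) K(y) dy`. -/
noncomputable def nonlocalOperator {d : ℕ} (s : ℝ) (K : Space d → ℝ) (w : Space d → ℝ)
    (x : Space d) : ℝ :=
  ∫ y, delta s w x y * K y

/-- The extremal operator `M_ρ^- w(x) = inf_K L_K w(x)` over all admissible kernels. The infimum is
taken in the extended reals, so that an infimum over the empty class is `+∞`. -/
noncomputable def pucciInf {d : ℕ} (s lam Lam ρ : ℝ) (w : Space d → ℝ) (x : Space d) : EReal :=
  ⨅ (K : Space d → ℝ) (_ : IsAdmissibleKernel s lam Lam ρ K), (nonlocalOperator s K w x : EReal)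

/-- `u ∈ L^∞(ℝ^d × I)`, for a function with values at every point: it is essentially bounded on
`ℝ^d × I`, and so is each of its time slices on `ℝ^d`. -/
structure IsBoundedOnStrip {d : ℕ} (I : Set ℝ) (u : Space d → ℝ → ℝ) : Prop where
  memLp : MemLp (fun p : Space d × ℝ => u p.1 p.2) ⊤ (volume.restrict (univ ×ˢ I))
  memLp_slice : ∀ t ∈ I, MemLp (fun x => u x t) ⊤ volume

/-- `φ` is an admissible test function on `B_ε(x₀) × (t₀ - ε, t₀]`: it is left-differentiable in
time and `C^{1,1}` in space. Only the values of `φ` on this cylinder matter. -/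
structure IsTestFunction {d : ℕ} (x₀ : Space d) (t₀ ε : ℝ) (φ : Space d → ℝ → ℝ) : Prop where
  left_differentiable : ∀ x ∈ Metric.ball x₀ ε, ∀ t ∈ Ioc (t₀ - ε) t₀,
    DifferentiableWithinAt ℝ (fun τ => φ x τ) (Iic t) t
  differentiable_space : ∀ t ∈ Ioc (t₀ - ε) t₀, ∀ x ∈ Metric.ball x₀ ε,
    DifferentiableAt ℝ (fun z => φ z t) x
  lipschitz_gradient : ∀ t ∈ Ioc (t₀ - ε) t₀, ∃ C : NNReal,
    LipschitzOnWith C (fun x => fderiv ℝ (fun z => φ z t) x) (Metric.ball x₀ ε)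

open Classical in
/-- The function equal to `φ` in `B_ε(x₀) × (t₀ - ε, t₀]` and to `u` elsewhere. -/
noncomputable def glue {d : ℕ} (x₀ : Space d) (t₀ ε : ℝ) (φ u : Space d → ℝ → ℝ)
    (x : Space d) (t : ℝ) : ℝ :=
  if x ∈ Metric.ball x₀ ε ∧ t ∈ Ioc (t₀ - ε) t₀ then φ x t else u x t

/-- The left derivative at `t`. -/
noncomputable def leftDeriv (g : ℝ → ℝ) (t : ℝ) : ℝ := derivWithin g (Iic t) t

/-- `u` solves `∂_t u - F(u) ≥ f` in `Ω × I` in the viscosity sense, where `F` acts on the time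
slices of a function. -/
structure IsViscositySupersolution {d : ℕ} (F : (Space d → ℝ) → Space d → EReal)
    (f : Space d → ℝ → ℝ) (Ω : Set (Space d)) (I : Set ℝ) (u : Space d → ℝ → ℝ) : Prop where
  bounded : IsBoundedOnStrip I u
  lsc : LowerSemicontinuousOn (fun p : Space d × ℝ => u p.1 p.2) (Ω ×ˢ I)
  test : ∀ x₀ ∈ Ω, ∀ t₀ ∈ I, ∀ ε : ℝ, 0 < ε →
    Metric.ball x₀ ε ×ˢ Ioc (t₀ - ε) t₀ ⊆ Ω ×ˢ I →
    ∀ φ : Space d → ℝ → ℝ, IsTestFunction x₀ t₀ ε φ →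
    u x₀ t₀ = φ x₀ t₀ →
    (∀ x ∈ Metric.ball x₀ ε, ∀ t ∈ Ioc (t₀ - ε) t₀, φ x t ≤ u x t) →
    (f x₀ t₀ : EReal) ≤
      (leftDeriv (fun t => glue x₀ t₀ ε φ u x₀ t) t₀ : EReal)
        - F (fun x => glue x₀ t₀ ε φ u x t₀) x₀

end NonlocalParabolic

open NonlocalParabolic

/-! The bound rests on the nonlocal tail alone; no covering or measure estimate is needed. Write
W(x) = (R+|x|)^{-d-2s} and F(t) = ∫ u(x,t) W(x) dx. For x in B_R, the kernel lower bound and ρ < R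
give K(y) ≥ λ W(x+y), so every value of u, near or far, feeds the operator at x. If u is touched
from below at (x₀,t₀) by a barrier m(t) b(x) + (function of t), with b a cutoff of B_R, then L_K
contributes at least λ F(t₀) up to an error of order R^{-2s} m(t₀), since L_K b = O(R^{-2s}) and ∫ b
W = O(R^{-2s}).

Hence the barrier m(t) b(x) - e (t-T) with m' ≈ λ F, m(T) = 0 and e slightly larger than the error
cannot be crossed. On a time interval of length a small multiple of R^{2s} the loss e (t-T) is about
half of m at most, so u ≥ (λ/2) ∫ F on B_{R/2} (`tailMass_le_of_touching`,
`exists_short_time_bound`).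

Longer intervals are reached by iteration: a lower bound h for u on B_{R/2} gives F ≥ c R^{-2s} h,
so mass accumulated early reappears in F just before the final time, where the short-time bound
applies (`exists_long_time_bound`). The number of iterations depends only on d, s, λ, Λ. The
right-hand side is removed by adding to u a function linear in time with values in [0, a], which
costs exactly the term -a. -/

namespace NonlocalParabolic

open Filter
open scoped Topology ENNReal NNReal

variable {d : ℕ} {s lam Lam ρ : ℝ} {K : Space d → ℝ}

/-! ### Dyadic summation of the kernel bounds -/

/-- The constant in the dyadic summation of the upper bound on the kernel. -/
noncomputable def dyadicConst (s Lam θ : ℝ) (e : ℕ) : ℝ :=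
  2 ^ e * Lam / (1 - θ ^ ((e : ℝ) - 2 * s))

lemma dyadicConst_nonneg (hLam : 0 < Lam) {θ : ℝ} {e : ℕ} (h1 : θ ^ ((e : ℝ) - 2 * s) < 1) :
    0 ≤ dyadicConst s Lam θ e :=
  div_nonneg (by positivity) (by linarith)

lemma lintegral_shell_le (hK : IsAdmissibleKernel s lam Lam ρ K) (e : ℕ) {r : ℝ} (hr : 0 < r) :
    ∫⁻ y in Metric.ball (0 : Space d) (2 * r) \ Metric.ball 0 r, ENNReal.ofReal (‖y‖ ^ e * K y)
      ≤ ENNReal.ofReal (2 ^ e * Lam * r ^ ((e : ℝ) - 2 * s)) := by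
  calc _ ≤ ∫⁻ y in Metric.ball (0 : Space d) (2 * r) \ Metric.ball 0 r,
        ENNReal.ofReal ((2 * r) ^ e) * ENNReal.ofReal (K y) := by
        refine setLIntegral_mono' (measurableSet_ball.diff measurableSet_ball) fun y hy => ?_
        rw [← ENNReal.ofReal_mul (by positivity)]
        refine ENNReal.ofReal_le_ofReal (mul_le_mul_of_nonneg_right ?_ (hK.nonneg y))
        have : ‖y‖ < 2 * r := by simpa using hy.1
        gcongr
    _ = ENNReal.ofReal ((2 * r) ^ e) *
        ∫⁻ y in Metric.ball (0 : Space d) (2 * r) \ Metric.ball 0 r, ENNReal.ofReal (K y) :=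
        lintegral_const_mul' _ _ ENNReal.ofReal_ne_top
    _ ≤ ENNReal.ofReal ((2 * r) ^ e) * ENNReal.ofReal (Lam * r ^ (-(2 * s))) := by
        gcongr; exact hK.upper_bound r hr
    _ = _ := by
        rw [← ENNReal.ofReal_mul (by positivity), sub_eq_add_neg, Real.rpow_add hr,
          Real.rpow_natCast]
        congr 1; ring

/-- The shell bounds form a geometric series of ratio θ^{e-2s}. Taking θ = 1/2 sums inwards (e > 2s)
and θ = 2 outwards (e < 2s). Countable subadditivity is enough, so neither disjointness nor
measurability of S enters. -/
lemma lintegral_shells_le (hK : IsAdmissibleKernel s lam Lam ρ K) (hLam : 0 < Lam)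
    {θ r : ℝ} (hθ : 0 < θ) (hr : 0 < r) (e : ℕ) (h1 : θ ^ ((e : ℝ) - 2 * s) < 1)
    {S : Set (Space d)}
    (hS : S ⊆ ⋃ k : ℕ, Metric.ball (0 : Space d) (2 * (r * θ ^ k)) \ Metric.ball 0 (r * θ ^ k)) :
    ∫⁻ y in S, ENNReal.ofReal (‖y‖ ^ e * K y)
      ≤ ENNReal.ofReal (dyadicConst s Lam θ e * r ^ ((e : ℝ) - 2 * s)) := by
  set q := θ ^ ((e : ℝ) - 2 * s) with hq
  have hq0 : 0 ≤ q := by positivity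
  refine (lintegral_mono_set hS).trans ((lintegral_iUnion_le _ _).trans ?_)
  calc _ ≤ ∑' k : ℕ, ENNReal.ofReal (2 ^ e * Lam * r ^ ((e : ℝ) - 2 * s) * q ^ k) := by
        refine ENNReal.tsum_le_tsum fun k => (lintegral_shell_le hK e (by positivity)).trans_eq ?_
        congr 1
        rw [Real.mul_rpow hr.le (by positivity), hq, ← Real.rpow_natCast θ k,
          ← Real.rpow_natCast (θ ^ _) k, ← Real.rpow_mul hθ.le, ← Real.rpow_mul hθ.le,
          mul_comm (k : ℝ)]
        ring
    _ = ENNReal.ofReal (∑' k : ℕ, 2 ^ e * Lam * r ^ ((e : ℝ) - 2 * s) * q ^ k) :=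
        (ENNReal.ofReal_tsum_of_nonneg (fun k => by positivity)
          ((summable_geometric_of_lt_one hq0 h1).mul_left _)).symm
    _ = _ := by
        rw [tsum_mul_left, tsum_geometric_of_lt_one hq0 h1, dyadicConst]
        congr 1; ring

lemma lintegral_ball_le (hK : IsAdmissibleKernel s lam Lam ρ K) (hs : 0 < s) (hLam : 0 < Lam)
    {R : ℝ} (hR : 0 < R) {p : ℕ} (hp : 2 * s < p) :
    ∫⁻ y in Metric.ball (0 : Space d) R, ENNReal.ofReal (‖y‖ ^ p * K y)
      ≤ ENNReal.ofReal (dyadicConst s Lam (1 / 2) p * R ^ ((p : ℝ) - 2 * s)) := by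
  -- The origin lies in no shell, but the weight ‖y‖^p vanishes there, so it can be dropped.
  have hp0 : p ≠ 0 := by
    rintro rfl
    simp at hp; linarith
  have h0 : ∫⁻ y in Metric.ball (0 : Space d) R, ENNReal.ofReal (‖y‖ ^ p * K y)
      = ∫⁻ y in Metric.ball (0 : Space d) R \ {0}, ENNReal.ofReal (‖y‖ ^ p * K y) := by
    rw [← lintegral_indicator measurableSet_ball,
      ← lintegral_indicator (measurableSet_ball.diff (measurableSet_singleton _))]
    congr 1; ext y
    by_cases hy : y = 0
    · subst hy; simp [hp0]
    · simp [indicator, hy]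
  rw [h0]
  refine lintegral_shells_le hK hLam (by norm_num) hR p
    (Real.rpow_lt_one (by norm_num) (by norm_num) (by linarith)) ?_
  rintro y ⟨hy, hy0⟩
  have hy0' : 0 < ‖y‖ := norm_pos_iff.2 hy0
  have hyR : ‖y‖ < R := by simpa using hy
  obtain ⟨n, hn1, hn2⟩ := exists_nat_pow_near (x := R / ‖y‖) (y := 2)
    (by rw [le_div_iff₀ hy0']; linarith) (by norm_num)
  rw [le_div_iff₀ hy0'] at hn1
  rw [div_lt_iff₀ hy0'] at hn2
  have e1 : R * (1 / 2) ^ n * 2 ^ n = R := by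
    rw [mul_assoc, ← mul_pow]; norm_num
  -- Shells contain their inner sphere but not their outer one: if ‖y‖ = R 2^{-n} the point is in
  -- shell n, otherwise in shell n + 1.
  rcases hn1.lt_or_eq with h | h
  · refine mem_iUnion.2 ⟨n + 1, ?_⟩
    simp only [Set.mem_sdiff, mem_ball_zero_iff, not_lt]
    have h2 : (0 : ℝ) < 2 ^ n := by positivity
    constructor
    · refine lt_of_mul_lt_mul_left ?_ h2.le
      calc 2 ^ n * ‖y‖ < R := h
        _ = _ := by rw [pow_succ (1 / 2 : ℝ)]; linarith
    · refine le_of_mul_le_mul_left ?_ h2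
      rw [pow_succ] at hn2 ⊢
      linarith
  · refine mem_iUnion.2 ⟨n, ?_⟩
    simp only [Set.mem_sdiff, mem_ball_zero_iff, not_lt]
    have h2 : (0 : ℝ) < 2 ^ n := by positivity
    have : ‖y‖ = R * (1 / 2) ^ n := by
      apply mul_left_cancel₀ h2.ne'
      linarith
    constructor <;> linarith

lemma lintegral_compl_ball_le (hK : IsAdmissibleKernel s lam Lam ρ K) (hLam : 0 < Lam)
    {R : ℝ} (hR : 0 < R) {q : ℕ} (hq : q < 2 * s) :
    ∫⁻ y in (Metric.ball (0 : Space d) R)ᶜ, ENNReal.ofReal (‖y‖ ^ q * K y)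
      ≤ ENNReal.ofReal (dyadicConst s Lam 2 q * R ^ ((q : ℝ) - 2 * s)) := by
  refine lintegral_shells_le hK hLam (by norm_num) hR q
    (Real.rpow_lt_one_of_one_lt_of_neg (by norm_num) (by linarith)) ?_
  intro y hy
  have hyR : R ≤ ‖y‖ := by simpa using hy
  obtain ⟨n, hn1, hn2⟩ := exists_nat_pow_near (x := ‖y‖ / R) (y := 2)
    (by rw [le_div_iff₀ hR]; linarith) (by norm_num)
  rw [le_div_iff₀ hR] at hn1
  rw [div_lt_iff₀ hR, pow_succ] at hn2
  refine mem_iUnion.2 ⟨n, ?_⟩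
  simp only [Set.mem_sdiff, mem_ball_zero_iff, not_lt]
  constructor <;> linarith

/-- A function that is `O((|y|/R)^p)` in `B_R` and `O((|y|/R)^q)` outside, with `q < 2s < p`, is
integrable against every admissible kernel, with the natural bound. -/
lemma integrable_mul_kernel (hK : IsAdmissibleKernel s lam Lam ρ K) (hs : 0 < s) (hLam : 0 < Lam)
    {R : ℝ} (hR : 0 < R) {p q : ℕ} (hp : 2 * s < p) (hq : q < 2 * s) {A : ℝ} (hA : 0 ≤ A)
    {h : Space d → ℝ} (hm : AEStronglyMeasurable h volume)
    (hin : ∀ y, ‖y‖ < R → |h y| ≤ A * (‖y‖ / R) ^ p)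
    (hout : ∀ y, R ≤ ‖y‖ → |h y| ≤ A * (‖y‖ / R) ^ q) :
    Integrable (fun y => h y * K y) volume ∧
      |∫ y, h y * K y| ≤
        A * (dyadicConst s Lam (1 / 2) p + dyadicConst s Lam 2 q) * R ^ (-(2 * s)) := by
  have hc1 : 0 ≤ dyadicConst s Lam (1 / 2) p := dyadicConst_nonneg hLam
    (Real.rpow_lt_one (by norm_num) (by norm_num) (by linarith))
  have hc2 : 0 ≤ dyadicConst s Lam 2 q := dyadicConst_nonneg hLam
    (Real.rpow_lt_one_of_one_lt_of_neg (by norm_num) (by linarith))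
  have key : ∀ (S : Set (Space d)) (hS : MeasurableSet S) (e : ℕ) (C : ℝ), 0 ≤ C →
      (∀ y ∈ S, |h y| ≤ A * (‖y‖ / R) ^ e) →
      ∫⁻ y in S, ENNReal.ofReal (‖y‖ ^ e * K y) ≤ ENNReal.ofReal (C * R ^ ((e : ℝ) - 2 * s)) →
      ∫⁻ y in S, ENNReal.ofReal |h y * K y| ≤ ENNReal.ofReal (A * C * R ^ (-(2 * s))) := by
    intro S hS e C hC hb hint
    calc _ ≤ ∫⁻ y in S, ENNReal.ofReal (A / R ^ e) * ENNReal.ofReal (‖y‖ ^ e * K y) := by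
          refine setLIntegral_mono' hS fun y hy => ?_
          rw [← ENNReal.ofReal_mul (by positivity), abs_mul, abs_of_nonneg (hK.nonneg y)]
          refine ENNReal.ofReal_le_ofReal ?_
          calc |h y| * K y ≤ A * (‖y‖ / R) ^ e * K y :=
                mul_le_mul_of_nonneg_right (hb y hy) (hK.nonneg y)
            _ = _ := by rw [div_pow]; ring
      _ = ENNReal.ofReal (A / R ^ e) * ∫⁻ y in S, ENNReal.ofReal (‖y‖ ^ e * K y) :=
          lintegral_const_mul' _ _ ENNReal.ofReal_ne_top
      _ ≤ ENNReal.ofReal (A / R ^ e) * ENNReal.ofReal (C * R ^ ((e : ℝ) - 2 * s)) := by gcongr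
      _ = _ := by
          rw [← ENNReal.ofReal_mul (by positivity), sub_eq_add_neg, Real.rpow_add hR,
            Real.rpow_natCast]
          congr 1; field_simp
  have htot : ∫⁻ y, ENNReal.ofReal |h y * K y| ≤ ENNReal.ofReal
      (A * (dyadicConst s Lam (1 / 2) p + dyadicConst s Lam 2 q) * R ^ (-(2 * s))) := by
    rw [← lintegral_add_compl _ (measurableSet_ball (x := (0 : Space d)) (ε := R))]
    refine (add_le_add
      (key _ measurableSet_ball p _ hc1 (fun y hy => hin y (by simpa using hy))
        (lintegral_ball_le hK hs hLam hR hp))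
      (key _ measurableSet_ball.compl q _ hc2 (fun y hy => hout y (by simpa using hy))
        (lintegral_compl_ball_le hK hLam hR hq))).trans_eq ?_
    rw [← ENNReal.ofReal_add (by positivity) (by positivity)]
    congr 1; ring
  have hmeas : AEStronglyMeasurable (fun y => h y * K y) volume :=
    hm.mul hK.aemeasurable.aestronglyMeasurable
  have hint : Integrable (fun y => h y * K y) volume := by
    refine ⟨hmeas, ?_⟩
    rw [hasFiniteIntegral_iff_norm]
    exact htot.trans_lt ENNReal.ofReal_lt_top
  refine ⟨hint, ?_⟩
  refine (norm_integral_le_integral_norm (fun y => h y * K y)).trans ?_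
  rw [integral_norm_eq_lintegral_enorm hmeas]
  refine ENNReal.toReal_le_of_le_ofReal (by positivity) ?_
  simpa [← ofReal_norm] using htot

lemma integrableOn_kernel_compl_ball (hK : IsAdmissibleKernel s lam Lam ρ K) (hs : 0 < s)
    (hLam : 0 < Lam) {r : ℝ} (hr : 0 < r) :
    IntegrableOn K (Metric.ball (0 : Space d) r)ᶜ volume := by
  refine ⟨hK.aemeasurable.aestronglyMeasurable.restrict, ?_⟩
  rw [hasFiniteIntegral_iff_norm]
  refine lt_of_le_of_lt ?_ ((lintegral_compl_ball_le hK hLam hr (q := 0)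
    (by simpa using hs)).trans_lt ENNReal.ofReal_lt_top)
  refine lintegral_mono fun y => ?_
  simp [abs_of_nonneg (hK.nonneg y)]

/-! ### Cutoffs on scale R -/

/-- A smooth cutoff adapted to `B_R`, with scale invariant bounds by `L`. -/
structure IsCutoff (L R : ℝ) (b : Space d → ℝ) : Prop where
  contDiff : ContDiff ℝ 2 b
  nonneg : ∀ x, 0 ≤ b x
  le_one : ∀ x, b x ≤ 1
  eq_one : ∀ x, ‖x‖ ≤ R / 2 → b x = 1
  eq_zero : ∀ x, 3 * R / 4 ≤ ‖x‖ → b x = 0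
  norm_fderiv_le : ∀ x, ‖fderiv ℝ b x‖ ≤ L / R
  fderiv_sub_le : ∀ x y, ‖fderiv ℝ b x - fderiv ℝ b y‖ ≤ L / R ^ 2 * ‖x - y‖

/-- All cutoffs are dilations of one fixed bump, so L is independent of R: each derivative costs a
factor R⁻¹. -/
lemma exists_isCutoff (d : ℕ) :
    ∃ L : ℝ, 0 ≤ L ∧ ∀ R : ℝ, 0 < R → ∃ b : Space d → ℝ, IsCutoff L R b := by
  let f : ContDiffBump (0 : Space d) := ⟨1 / 2, 3 / 4, by norm_num, by norm_num⟩
  have hf : ContDiff ℝ 2 f := f.contDiff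
  have hf' : ContDiff ℝ 1 (fderiv ℝ f) := hf.fderiv_right (by norm_num)
  obtain ⟨C1, h1⟩ := ContDiff.lipschitzWith_of_hasCompactSupport f.hasCompactSupport hf (by simp)
  obtain ⟨C2, h2⟩ := ContDiff.lipschitzWith_of_hasCompactSupport
    (f.hasCompactSupport.fderiv (𝕜 := ℝ)) hf' (by simp)
  refine ⟨C1 + C2, by positivity, fun R hR => ⟨fun x => f (R⁻¹ • x), ?_⟩⟩
  have hfd : ∀ x, fderiv ℝ (fun x => f (R⁻¹ • x)) x = R⁻¹ • fderiv ℝ f (R⁻¹ • x) := by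
    intro x
    exact fderiv_comp_smul R⁻¹
  have hn : ∀ x : Space d, ‖R⁻¹ • x‖ = ‖x‖ / R := by
    intro x
    rw [norm_smul, norm_inv, Real.norm_of_nonneg hR.le]; ring
  refine ⟨hf.comp (contDiff_const_smul _), fun x => f.nonneg, fun x => f.le_one, ?_, ?_, ?_, ?_⟩
  · intro x hx
    refine f.one_of_mem_closedBall ?_
    rw [mem_closedBall_zero_iff, hn, div_le_iff₀ hR]
    change ‖x‖ ≤ 1 / 2 * R
    linarith
  · intro x hx
    refine f.zero_of_le_dist ?_
    rw [dist_zero_right, hn, le_div_iff₀ hR]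
    change 3 / 4 * R ≤ _
    linarith
  · intro x
    rw [hfd, norm_smul, norm_inv, Real.norm_of_nonneg hR.le]
    have := norm_fderiv_le_of_lipschitz ℝ h1 (x₀ := R⁻¹ • x)
    rw [div_eq_inv_mul]
    gcongr
    linarith [C2.coe_nonneg]
  · intro x y
    rw [hfd, hfd, ← smul_sub, norm_smul, norm_inv, Real.norm_of_nonneg hR.le]
    have := h2.norm_sub_le (R⁻¹ • x) (R⁻¹ • y)
    rw [← smul_sub, hn] at this
    calc _ ≤ R⁻¹ * (C2 * (‖x - y‖ / R)) := by gcongr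
      _ ≤ R⁻¹ * ((C1 + C2) * (‖x - y‖ / R)) := by gcongr; linarith [C1.coe_nonneg]
      _ = _ := by field_simp

namespace IsCutoff

variable {L R : ℝ} {b : Space d → ℝ}

lemma differentiable (hb : IsCutoff L R b) : Differentiable ℝ b :=
  hb.contDiff.differentiable (by norm_num)

lemma abs_sub_le_one (hb : IsCutoff L R b) (x y : Space d) : |b (x + y) - b x| ≤ 1 :=
  abs_sub_le_iff.2 ⟨by linarith [hb.le_one (x + y), hb.nonneg x],
    by linarith [hb.le_one x, hb.nonneg (x + y)]⟩

lemma abs_sub_le (hb : IsCutoff L R b) (x y : Space d) :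
    |b (x + y) - b x| ≤ L * (‖y‖ / R) := by
  have := convex_univ.norm_image_sub_le_of_norm_fderiv_le (f := b) (𝕜 := ℝ)
    (fun z _ => hb.differentiable z) (fun z _ => hb.norm_fderiv_le z)
    (mem_univ x) (mem_univ (x + y))
  rw [add_sub_cancel_left] at this
  exact this.trans_eq (by ring)

lemma abs_fderiv_le (hb : IsCutoff L R b) (x y : Space d) :
    |fderiv ℝ b x y| ≤ L * (‖y‖ / R) :=
  ((fderiv ℝ b x).le_of_opNorm_le (hb.norm_fderiv_le x) y).trans_eq (by ring)

lemma abs_taylor_le (hb : IsCutoff L R b) (hL : 0 ≤ L) (x y : Space d) :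
    |b (x + y) - b x - fderiv ℝ b x y| ≤ L * (‖y‖ / R) ^ 2 := by
  have := (convex_closedBall x ‖y‖).norm_image_sub_le_of_norm_fderiv_le' (f := b) (𝕜 := ℝ)
    (φ := fderiv ℝ b x) (C := L / R ^ 2 * ‖y‖) (x := x) (y := x + y)
    (fun z _ => hb.differentiable z)
    (fun z hz => (hb.fderiv_sub_le z x).trans (by
      have : ‖z - x‖ ≤ ‖y‖ := by simpa [dist_eq_norm] using hz
      gcongr))
    (by simp) (by simp)
  rw [add_sub_cancel_left] at this
  exact this.trans_eq (by ring)

end IsCutoff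

/-! ### Cancellation on annuli when s = 1/2 -/

lemma integrableOn_annulus (hK : IsAdmissibleKernel s lam Lam ρ K) (hs : 0 < s)
    (hLam : 0 < Lam) {r r' : ℝ} (hr : 0 < r) :
    IntegrableOn (fun y => K y • y) (Metric.ball (0 : Space d) r' \ Metric.ball 0 r) volume := by
  have h1 : IntegrableOn (fun y => r' * K y) (Metric.ball (0 : Space d) r' \ Metric.ball 0 r)
      volume :=
    ((integrableOn_kernel_compl_ball hK hs hLam hr).mono_set (fun y hy => hy.2)).const_mul r'
  refine Integrable.mono' h1 (hK.aemeasurable.aestronglyMeasurable.smul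
    aestronglyMeasurable_id).restrict ?_
  refine ae_restrict_of_forall_mem (measurableSet_ball.diff measurableSet_ball) fun y hy => ?_
  have : ‖y‖ < r' := by simpa using hy.1
  simp only [norm_smul, Real.norm_of_nonneg (hK.nonneg y)]
  rw [mul_comm]
  exact mul_le_mul_of_nonneg_right this.le (hK.nonneg y)

lemma norm_integral_subset_shell_le (hK : IsAdmissibleKernel s lam Lam ρ K) (hLam : 0 < Lam)
    (hs : s = 1 / 2) {r : ℝ} (hr : 0 < r) {S : Set (Space d)}
    (hS : S ⊆ Metric.ball (0 : Space d) (2 * r) \ Metric.ball 0 r) :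
    ‖∫ y in S, K y • y‖ ≤ 2 * Lam := by
  refine (norm_integral_le_lintegral_norm _).trans (ENNReal.toReal_le_of_le_ofReal
    (by positivity) ?_)
  refine (lintegral_mono_set hS).trans ?_
  refine le_trans (le_of_eq ?_) ((lintegral_shell_le hK 1 hr).trans_eq ?_)
  · refine lintegral_congr fun y => ?_
    rw [norm_smul, Real.norm_of_nonneg (hK.nonneg y), pow_one, mul_comm]
  · subst hs; norm_num

/-- Full dyadic shells are peeled off from the inside and contribute zero by cancellation. What
remains is part of a single shell, so the bound does not grow logarithmically in r'/r. -/
lemma norm_integral_annulus_le (hK : IsAdmissibleKernel s lam Lam ρ K) (hLam : 0 < Lam)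
    (hs : s = 1 / 2) {r r' : ℝ} (hr : 0 < r) :
    ‖∫ y in Metric.ball (0 : Space d) r' \ Metric.ball 0 r, K y • y‖ ≤ 2 * Lam := by
  obtain ⟨n, hn⟩ := pow_unbounded_of_one_lt (r' / r) (one_lt_two (α := ℝ))
  rw [div_lt_iff₀ hr] at hn
  induction n generalizing r with
  | zero =>
    refine norm_integral_subset_shell_le hK hLam hs hr (sdiff_subset_sdiff_left ?_)
    exact Metric.ball_subset_ball (by simp at hn; linarith)
  | succ n ih =>
    rcases le_total r' (2 * r) with h | h
    · exact norm_integral_subset_shell_le hK hLam hs hr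
        (sdiff_subset_sdiff_left (Metric.ball_subset_ball h))
    · have h2 := ih (r := 2 * r) (by positivity) (by rw [pow_succ] at hn; linarith)
      have e : Metric.ball (0 : Space d) r' \ Metric.ball 0 r
          = (Metric.ball 0 (2 * r) \ Metric.ball 0 r) ∪
            (Metric.ball 0 r' \ Metric.ball 0 (2 * r)) := by
        ext y
        simp only [Set.mem_sdiff, mem_ball_zero_iff, not_lt, mem_union]
        constructor
        · rintro ⟨h3, h4⟩
          rcases lt_or_ge ‖y‖ (2 * r) with h5 | h5
          · exact Or.inl ⟨h5, h4⟩
          · exact Or.inr ⟨h3, h5⟩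
        · rintro (⟨h3, h4⟩ | ⟨h3, h4⟩)
          · exact ⟨by linarith, h4⟩
          · exact ⟨h3, by linarith⟩
      rw [e, setIntegral_union _ (measurableSet_ball.diff measurableSet_ball)
        (integrableOn_annulus hK (by rw [hs]; norm_num) hLam hr)
        (integrableOn_annulus hK (by rw [hs]; norm_num) hLam (by positivity)),
        hK.cancellation hs r hr, zero_add]
      · exact h2
      · rw [Set.disjoint_left]
        intro y hy hy'
        exact hy'.2 hy.1

/-- Needed because `delta` truncates the gradient term at radius 1 for s = 1/2, whereas
scale-invariant estimates require truncation at R. -/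
lemma linear_annulus (hK : IsAdmissibleKernel s lam Lam ρ K) (hLam : 0 < Lam)
    (hs : s = 1 / 2) {r r' : ℝ} (hr : 0 < r) (ℓ : Space d →L[ℝ] ℝ) :
    Integrable (fun y => (Metric.ball (0 : Space d) r' \ Metric.ball 0 r).indicator
        (fun z => ℓ z) y * K y) volume ∧
      |∫ y, (Metric.ball (0 : Space d) r' \ Metric.ball 0 r).indicator (fun z => ℓ z) y * K y|
        ≤ ‖ℓ‖ * (2 * Lam) := by
  have hI := integrableOn_annulus hK (by rw [hs]; norm_num) hLam hr (r' := r')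
  have e : (fun y => (Metric.ball (0 : Space d) r' \ Metric.ball 0 r).indicator
      (fun z => ℓ z) y * K y) = (Metric.ball (0 : Space d) r' \ Metric.ball 0 r).indicator
        (fun y => ℓ (K y • y)) := by
    ext y
    by_cases hy : y ∈ Metric.ball (0 : Space d) r' \ Metric.ball 0 r
    · simp only [indicator_of_mem hy, map_smul, smul_eq_mul, mul_comm]
    · simp only [indicator_of_notMem hy, zero_mul]
  have hm : MeasurableSet (Metric.ball (0 : Space d) r' \ Metric.ball 0 r) :=
    measurableSet_ball.diff measurableSet_ball
  rw [e, integrable_indicator_iff hm, integral_indicator hm, ℓ.integral_comp_comm hI]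
  refine ⟨ℓ.integrable_comp hI, ?_⟩
  exact (ℓ.le_opNorm _).trans (by gcongr; exact norm_integral_annulus_le hK hLam hs hr)

/-! ### Admissible operators applied to cutoffs -/

lemma aestronglyMeasurable_delta {b : Space d → ℝ} (hb : Continuous b) (x : Space d) :
    AEStronglyMeasurable (fun y => delta s b x y) volume := by
  have h1 : Continuous fun y => b (x + y) - b x := by fun_prop
  unfold delta
  split_ifs
  · exact h1.aestronglyMeasurable
  · exact h1.aestronglyMeasurable.sub
      ((fderiv ℝ b x).continuous.aestronglyMeasurable.indicator measurableSet_ball)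
  · exact h1.aestronglyMeasurable.sub (fderiv ℝ b x).continuous.aestronglyMeasurable

/-- Admissible operators applied to a cutoff on scale `R` are of order `R^{-2s}`. -/
lemma exists_nonlocalOperator_cutoff_bound (d : ℕ) (hs0 : 0 < s) (hs1 : s < 1) (lam : ℝ)
    (hLam : 0 < Lam) {L : ℝ} (hL : 0 ≤ L) :
    ∃ C : ℝ, 0 ≤ C ∧ ∀ (ρ R : ℝ) (K b : Space d → ℝ) (x : Space d), 0 < R →
      IsAdmissibleKernel s lam Lam ρ K → IsCutoff L R b →
      Integrable (fun y => delta s b x y * K y) volume ∧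
        |nonlocalOperator s K b x| ≤ C * R ^ (-(2 * s)) := by
  -- The exponents (p, q), with q < 2s < p, record the size of the difference inside and outside
  -- B_R: (1, 0) without a gradient term, (2, 0) with the gradient truncated at R, and (2, 1) with
  -- the full gradient.
  rcases lt_trichotomy s (1 / 2) with hs | hs | hs
  · refine ⟨(L + 1) * (dyadicConst s Lam (1 / 2) 1 + dyadicConst s Lam 2 0), ?_, ?_⟩
    · have hc1 : 0 ≤ dyadicConst s Lam (1 / 2) 1 := dyadicConst_nonneg hLam
        (Real.rpow_lt_one (by norm_num) (by norm_num) (by norm_num; linarith))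
      have hc2 : 0 ≤ dyadicConst s Lam 2 0 := dyadicConst_nonneg hLam
        (Real.rpow_lt_one_of_one_lt_of_neg (by norm_num) (by norm_num; linarith))
      positivity
    · intro ρ R K b x hR hK hb
      refine integrable_mul_kernel hK hs0 hLam hR (p := 1) (q := 0) (by norm_num; linarith)
        (by norm_num; linarith) (by positivity)
        (aestronglyMeasurable_delta hb.contDiff.continuous x) ?_ ?_
      · intro y _
        rw [delta, if_pos hs, pow_one]
        refine (hb.abs_sub_le x y).trans ?_
        gcongr; linarith
      · intro y _
        rw [delta, if_pos hs, pow_zero]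
        linarith [hb.abs_sub_le_one x y]
  · refine ⟨(L + 1) * (dyadicConst s Lam (1 / 2) 2 + dyadicConst s Lam 2 0) + 4 * L * Lam, ?_, ?_⟩
    · have hc1 : 0 ≤ dyadicConst s Lam (1 / 2) 2 := dyadicConst_nonneg hLam
        (Real.rpow_lt_one (by norm_num) (by norm_num) (by norm_num; linarith))
      have hc2 : 0 ≤ dyadicConst s Lam 2 0 := dyadicConst_nonneg hLam
        (Real.rpow_lt_one_of_one_lt_of_neg (by norm_num) (by norm_num; linarith))
      positivity
    · intro ρ R K b x hR hK hb
      set ℓ := fderiv ℝ b x with hℓ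
      obtain ⟨hi1, hb1⟩ := integrable_mul_kernel hK hs0 hLam hR (p := 2) (q := 0)
        (A := L + 1)
        (h := fun y => b (x + y) - b x - (Metric.ball (0 : Space d) R).indicator (fun z => ℓ z) y)
        (by norm_num; linarith) (by norm_num; linarith) (by positivity)
        ((by have := hb.contDiff.continuous
             fun_prop : Continuous fun y => b (x + y) - b x).aestronglyMeasurable.sub
          (ℓ.continuous.aestronglyMeasurable.indicator measurableSet_ball))
        (by
          intro y hy
          rw [indicator_of_mem (by simpa using hy)]
          refine (hb.abs_taylor_le hL x y).trans ?_
          gcongr; linarith)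
        (by
          intro y hy
          rw [indicator_of_notMem (by simpa using hy), sub_zero, pow_zero]
          linarith [hb.abs_sub_le_one x y])
      -- Changing the truncation radius from 1 to R costs a linear term on the annulus between them.
      -- Both orders are included; whichever of R and 1 is larger, one of the two annuli is empty.
      obtain ⟨hi2, hb2⟩ := linear_annulus hK hLam hs one_pos ℓ (r' := R)
      obtain ⟨hi3, hb3⟩ := linear_annulus hK hLam hs hR ℓ (r' := 1)
      have e : (fun y => delta s b x y * K y) = fun y =>
          (b (x + y) - b x - (Metric.ball (0 : Space d) R).indicator (fun z => ℓ z) y) * K y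
          + ((Metric.ball (0 : Space d) R \ Metric.ball 0 1).indicator (fun z => ℓ z) y * K y
          - (Metric.ball (0 : Space d) 1 \ Metric.ball 0 R).indicator (fun z => ℓ z) y * K y) := by
        ext y
        rw [delta, if_neg (by linarith), if_pos hs, ← hℓ]
        by_cases h1 : y ∈ Metric.ball (0 : Space d) R <;>
        by_cases h2 : y ∈ Metric.ball (0 : Space d) 1 <;>
        simp [indicator, -Metric.mem_ball, h1, h2] <;> ring
      have hn : ‖ℓ‖ * (2 * Lam) ≤ 2 * L * Lam * R ^ (-(2 * s)) := by
        have h1 : R ^ (-(2 * s)) = R⁻¹ := by rw [hs]; norm_num [Real.rpow_neg_one]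
        have := hb.norm_fderiv_le x
        rw [h1]
        calc ‖ℓ‖ * (2 * Lam) ≤ L / R * (2 * Lam) := by gcongr
          _ = _ := by ring
      unfold nonlocalOperator
      rw [e]
      have hi4 : Integrable (fun y =>
          (Metric.ball (0 : Space d) R \ Metric.ball 0 1).indicator (fun z => ℓ z) y * K y
          - (Metric.ball (0 : Space d) 1 \ Metric.ball 0 R).indicator (fun z => ℓ z) y * K y)
          volume := hi2.sub hi3
      refine ⟨hi1.add hi4, ?_⟩
      rw [integral_add hi1 hi4, integral_sub hi2 hi3]
      refine (abs_add_le _ _).trans ?_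
      refine (add_le_add hb1 ((abs_sub _ _).trans (add_le_add hb2 hb3))).trans ?_
      linarith
  · refine ⟨2 * L * (dyadicConst s Lam (1 / 2) 2 + dyadicConst s Lam 2 1), ?_, ?_⟩
    · have hc1 : 0 ≤ dyadicConst s Lam (1 / 2) 2 := dyadicConst_nonneg hLam
        (Real.rpow_lt_one (by norm_num) (by norm_num) (by norm_num; linarith))
      have hc2 : 0 ≤ dyadicConst s Lam 2 1 := dyadicConst_nonneg hLam
        (Real.rpow_lt_one_of_one_lt_of_neg (by norm_num) (by norm_num; linarith))
      positivity
    · intro ρ R K b x hR hK hb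
      refine integrable_mul_kernel hK hs0 hLam hR (p := 2) (q := 1) (by norm_num; linarith)
        (by norm_num; linarith) (by positivity)
        (aestronglyMeasurable_delta hb.contDiff.continuous x) ?_ ?_
      · intro y _
        rw [delta, if_neg (by linarith), if_neg (by linarith)]
        refine (hb.abs_taylor_le hL x y).trans ?_
        gcongr; linarith
      · intro y _
        rw [delta, if_neg (by linarith), if_neg (by linarith), pow_one]
        refine (abs_sub _ _).trans ?_
        linarith [hb.abs_sub_le x y, hb.abs_fderiv_le x y]

/-! ### The tail weight and its comparison with kernels -/

/-- The tail weight `(R + |x|)^{-d-2s}`. -/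
noncomputable def tailWeight (d : ℕ) (s R : ℝ) (x : Space d) : ℝ :=
  ((R + ‖x‖) ^ ((d : ℝ) + 2 * s))⁻¹

lemma tailWeight_pos {R : ℝ} (hR : 0 < R) (x : Space d) : 0 < tailWeight d s R x := by
  unfold tailWeight; positivity

lemma tailWeight_eq_rpow {R : ℝ} (hR : 0 < R) (x : Space d) :
    tailWeight d s R x = (R + ‖x‖) ^ (-((d : ℝ) + 2 * s)) :=
  (Real.rpow_neg (by positivity) _).symm

lemma tailWeight_le (hs : 0 < s) {R : ℝ} (hR : 0 < R) (x : Space d) :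
    tailWeight d s R x ≤ R ^ (-((d : ℝ) + 2 * s)) := by
  rw [tailWeight_eq_rpow hR]
  refine Real.rpow_le_rpow_of_nonpos hR (by linarith [norm_nonneg x]) ?_
  have : (0 : ℝ) ≤ d := Nat.cast_nonneg d
  linarith

lemma le_tailWeight (hs : 0 < s) {R : ℝ} (hR : 0 < R) {x : Space d} (hx : ‖x‖ < R / 2) :
    (3 / 2 * R) ^ (-((d : ℝ) + 2 * s)) ≤ tailWeight d s R x := by
  rw [tailWeight_eq_rpow hR]
  refine Real.rpow_le_rpow_of_nonpos (by positivity) (by linarith) ?_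
  have : (0 : ℝ) ≤ d := Nat.cast_nonneg d
  linarith

lemma continuous_tailWeight {R : ℝ} (hR : 0 < R) : Continuous (tailWeight d s R) := by
  have h : ∀ x : Space d, R + ‖x‖ ≠ 0 := fun x => by positivity
  unfold tailWeight
  refine Continuous.inv₀ ?_ fun x => by positivity
  exact (by fun_prop : Continuous fun x : Space d => R + ‖x‖).rpow_const fun x => Or.inl (h x)

lemma integrable_tailWeight (hs : 0 < s) {R : ℝ} (hR : 0 < R) :
    Integrable (tailWeight d s R) volume := by
  have h1 : Integrable (fun x : Space d => (1 + ‖x‖) ^ (-((d : ℝ) + 2 * s))) volume :=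
    integrable_one_add_norm (by simp; linarith)
  refine (h1.const_mul ((min R 1) ^ (-((d : ℝ) + 2 * s)))).mono'
    (continuous_tailWeight hR).aestronglyMeasurable (Eventually.of_forall fun x => ?_)
  have hm : 0 < min R 1 := lt_min hR one_pos
  rw [Real.norm_of_nonneg (tailWeight_pos hR x).le, tailWeight_eq_rpow hR,
    ← Real.mul_rpow hm.le (by positivity)]
  have : (0 : ℝ) ≤ d := Nat.cast_nonneg d
  refine Real.rpow_le_rpow_of_nonpos (by positivity) ?_ (by linarith)
  rw [mul_add, mul_one]
  exact add_le_add (min_le_left _ _)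
    (mul_le_of_le_one_left (norm_nonneg x) (min_le_right _ _))

lemma volume_ball_toReal {r : ℝ} (hr : 0 < r) :
    (volume (Metric.ball (0 : Space d) r)).toReal
      = r ^ (d : ℝ) * (volume (Metric.ball (0 : Space d) 1)).toReal := by
  rw [Measure.addHaar_ball_of_pos _ _ hr, ENNReal.toReal_mul, ENNReal.toReal_ofReal (by positivity),
    Real.rpow_natCast]
  simp

lemma integral_cutoff_tailWeight_le (hs : 0 < s) {L R : ℝ} (hR : 0 < R) {b : Space d → ℝ}
    (hb : IsCutoff L R b) :
    ∫ x, b x * tailWeight d s R x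
      ≤ (volume (Metric.ball (0 : Space d) 1)).toReal * R ^ (-(2 * s)) := by
  have h1 : ∫ x, b x * tailWeight d s R x ≤ ∫ x, (Metric.ball (0 : Space d) R).indicator
      (fun _ => R ^ (-((d : ℝ) + 2 * s))) x := by
    refine integral_mono_of_nonneg
      (Eventually.of_forall fun x => mul_nonneg (hb.nonneg x) (tailWeight_pos hR x).le)
      ((integrable_indicator_iff measurableSet_ball).2
        (integrableOn_const (measure_ball_lt_top.ne)))
      (Eventually.of_forall fun x => ?_)
    by_cases hx : x ∈ Metric.ball (0 : Space d) R
    · rw [indicator_of_mem hx]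
      calc b x * tailWeight d s R x ≤ 1 * tailWeight d s R x :=
            mul_le_mul_of_nonneg_right (hb.le_one x) (tailWeight_pos hR x).le
        _ ≤ _ := by rw [one_mul]; exact tailWeight_le hs hR x
    · rw [indicator_of_notMem hx]
      have : R ≤ ‖x‖ := by simpa using hx
      simp [hb.eq_zero x (by linarith)]
  refine h1.trans_eq ?_
  rw [integral_indicator measurableSet_ball, setIntegral_const, measureReal_def,
    volume_ball_toReal hR, smul_eq_mul, neg_add, Real.rpow_add hR]
  have : R ^ (d : ℝ) * R ^ (-(d : ℝ)) = 1 := by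
    rw [← Real.rpow_add hR, add_neg_cancel, Real.rpow_zero]
  linear_combination (volume (Metric.ball (0 : Space d) 1)).toReal * R ^ (-(2 * s)) * this

/-- The mass of the tail weight in `B_{R/2}`, on the unit scale. -/
noncomputable def innerMass (d : ℕ) (s : ℝ) : ℝ :=
  (volume (Metric.ball (0 : Space d) 1)).toReal * (1 / 2) ^ (d : ℝ)
    * (3 / 2) ^ (-((d : ℝ) + 2 * s))

lemma innerMass_pos (d : ℕ) (s : ℝ) : 0 < innerMass d s := by
  have : 0 < (volume (Metric.ball (0 : Space d) 1)).toReal :=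
    ENNReal.toReal_pos (Metric.measure_ball_pos _ _ one_pos).ne' measure_ball_lt_top.ne
  unfold innerMass; positivity

/-- This is the feedback used in the iteration: a pointwise lower bound on B_{R/2} returns as a
lower bound on the weighted mass, since the weight is at least (3R/2)^{-d-2s} on a ball of volume
comparable to R^d. -/
lemma innerMass_mul_le (hs : 0 < s) {R h : ℝ} (hR : 0 < R) (hh : 0 ≤ h) {w : Space d → ℝ}
    (hw : Integrable (fun x => w x * tailWeight d s R x) volume) (hw0 : ∀ x, 0 ≤ w x)
    (hwh : ∀ x, ‖x‖ < R / 2 → h ≤ w x) :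
    innerMass d s * R ^ (-(2 * s)) * h ≤ ∫ x, w x * tailWeight d s R x := by
  have h1 : ∫ x, (Metric.ball (0 : Space d) (R / 2)).indicator
      (fun _ => h * (3 / 2 * R) ^ (-((d : ℝ) + 2 * s))) x
      ≤ ∫ x, w x * tailWeight d s R x := by
    refine integral_mono_of_nonneg (Eventually.of_forall fun x => ?_) hw
      (Eventually.of_forall fun x => ?_)
    · exact indicator_nonneg (fun _ _ => by positivity) x
    · by_cases hx : x ∈ Metric.ball (0 : Space d) (R / 2)
      · rw [indicator_of_mem hx]
        have hx' : ‖x‖ < R / 2 := by simpa using hx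
        exact mul_le_mul (hwh x hx') (le_tailWeight hs hR hx') (by positivity) (hw0 x)
      · rw [indicator_of_notMem hx]
        exact mul_nonneg (hw0 x) (tailWeight_pos hR x).le
  refine le_trans (le_of_eq ?_) h1
  rw [integral_indicator measurableSet_ball, setIntegral_const, measureReal_def,
    volume_ball_toReal (by positivity), smul_eq_mul, Real.mul_rpow (by norm_num) hR.le,
    show R / 2 = 1 / 2 * R by ring, Real.mul_rpow (by norm_num) hR.le, innerMass,
    neg_add, Real.rpow_add hR]
  have : R ^ (d : ℝ) * R ^ (-(d : ℝ)) = 1 := by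
    rw [← Real.rpow_add hR, add_neg_cancel, Real.rpow_zero]
  linear_combination -(volume (Metric.ball (0 : Space d) 1)).toReal * (1 / 2) ^ (d : ℝ)
    * (3 / 2) ^ (-(d : ℝ) + -(2 * s)) * R ^ (-(2 * s)) * h * this

/-- Both |y| ≤ |x+y| + |x| and ρ are at most R + |x+y|, so the weight lies below both entries of the
truncated kernel. This is where ρ < R enters. -/
lemma tailWeight_le_kernel (hK : IsAdmissibleKernel s lam Lam ρ K) (hs : 0 < s) (hlam : 0 < lam)
    {R : ℝ} (hρ : 0 ≤ ρ) (hρR : ρ < R) {x y : Space d} (hx : ‖x‖ < R) (hy : y ≠ 0) :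
    lam * tailWeight d s R (x + y) ≤ K y := by
  have hR : 0 < R := hρ.trans_lt hρR
  refine le_trans ?_ (hK.lower_bound y hy)
  have hd : (0 : ℝ) ≤ d := Nat.cast_nonneg d
  have h1 : ‖y‖ ≤ R + ‖x + y‖ := by
    have : ‖y‖ ≤ ‖x + y‖ + ‖x‖ := by
      calc ‖y‖ = ‖(x + y) - x‖ := by rw [add_sub_cancel_left]
        _ ≤ _ := norm_sub_le _ _
    linarith
  have e : -(d : ℝ) - 2 * s = -((d : ℝ) + 2 * s) := by ring
  have h2 : (R + ‖x + y‖) ^ (-((d : ℝ) + 2 * s)) ≤ ‖y‖ ^ (-((d : ℝ) + 2 * s)) :=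
    Real.rpow_le_rpow_of_nonpos (norm_pos_iff.2 hy) h1 (by linarith)
  rw [tailWeight_eq_rpow hR]
  refine mul_le_mul_of_nonneg_left ?_ hlam.le
  unfold truncatedKernel
  rw [e]
  split_ifs with h0
  · exact h2
  · refine le_min h2 (Real.rpow_le_rpow_of_nonpos (lt_of_le_of_ne hρ (Ne.symm h0)) ?_
      (by linarith))
    linarith [norm_nonneg (x + y)]

lemma integrable_mul_tailWeight (hs : 0 < s) {R : ℝ} (hR : 0 < R) {w : Space d → ℝ}
    (hw : MemLp w ⊤ volume) : Integrable (fun x => w x * tailWeight d s R x) volume :=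
  (integrable_tailWeight hs hR).mul_of_top_right hw

lemma IsCutoff.memLp {L R : ℝ} {b : Space d → ℝ} (hb : IsCutoff L R b) : MemLp b ⊤ volume :=
  memLp_top_of_bound hb.contDiff.continuous.aestronglyMeasurable 1
    (Eventually.of_forall fun x => by
      rw [Real.norm_of_nonneg (hb.nonneg x)]; exact hb.le_one x)

/-! ### The operator at a touching point -/

/-- Lower bound for `L_K v` at a point near which `v` is an affine function of a cutoff that stays
below the bounded function `w`, while `v = w` elsewhere. -/
lemma le_nonlocalOperator_glued (hK : IsAdmissibleKernel s lam Lam ρ K) (hs : 0 < s)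
    (hlam : 0 < lam) (hLam : 0 < Lam) {L R : ℝ} (hρ : 0 ≤ ρ) (hρR : ρ < R) {b : Space d → ℝ}
    (hb : IsCutoff L R b) {x₀ : Space d} (hx₀ : ‖x₀‖ < R)
    (hbi : Integrable (fun y => delta s b x₀ y * K y) volume)
    {w v : Space d → ℝ} (hw : MemLp w ⊤ volume) {ε M c₀ : ℝ} (hε : 0 < ε)
    (hM : 0 ≤ M) (hc₀ : c₀ ≤ 0)
    (hv1 : ∀ z ∈ Metric.ball x₀ ε, v z = M * b z + c₀)
    (hv2 : ∀ z ∉ Metric.ball x₀ ε, v z = w z) (hle : ∀ z, M * b z + c₀ ≤ w z) :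
    M * nonlocalOperator s K b x₀ + lam * ((∫ x, w x * tailWeight d s R x)
        - M * (∫ x, b x * tailWeight d s R x)
        - ∫ x in Metric.ball x₀ ε, w x * tailWeight d s R x)
      ≤ nonlocalOperator s K v x₀ := by
  have hR : 0 < R := hρ.trans_lt hρR
  set W := tailWeight d s R with hW
  let G : Space d → ℝ := fun z => w z - (M * b z + c₀)
  -- D is the gap between v and the barrier. It is nonnegative and vanishes near x₀, so `L_K v = M
  -- L_K b + ∫ D(x₀+y) K(y) dy` with no singularity in the last integral, and the kernel may be
  -- replaced there by its lower bound.
  let D : Space d → ℝ := fun z => v z - (M * b z + c₀)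
  have hG : MemLp G ⊤ volume :=
    hw.sub ((hb.memLp.const_mul M).add (memLp_top_const c₀))
  have hG0 : ∀ z, 0 ≤ G z := fun z => sub_nonneg.2 (hle z)
  have hD1 : ∀ z ∈ Metric.ball x₀ ε, D z = 0 := fun z hz => by simp [D, hv1 z hz]
  have hD2 : ∀ z ∉ Metric.ball x₀ ε, D z = G z := fun z hz => by simp [D, G, hv2 z hz]
  have hD0 : ∀ z, 0 ≤ D z := fun z => by
    by_cases hz : z ∈ Metric.ball x₀ ε
    · rw [hD1 z hz]
    · rw [hD2 z hz]; exact hG0 z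
  have hDind : D = (Metric.ball x₀ ε)ᶜ.indicator G := by
    ext z
    by_cases hz : z ∈ Metric.ball x₀ ε
    · rw [hD1 z hz, indicator_of_notMem (by simpa using hz)]
    · rw [hD2 z hz, indicator_of_mem (by simpa using hz)]
  have hDL : MemLp D ⊤ volume := hDind ▸ hG.indicator measurableSet_ball.compl
  have hball : ∀ y : Space d, x₀ + y ∈ Metric.ball x₀ ε ↔ y ∈ Metric.ball (0 : Space d) ε := by
    intro y; simp
  have hDK : Integrable (fun y => D (x₀ + y) * K y) volume := by
    have h1 : Integrable (fun y => D (x₀ + y) * (Metric.ball (0 : Space d) ε)ᶜ.indicator K y)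
        volume :=
      ((integrable_indicator_iff measurableSet_ball.compl).2
        (integrableOn_kernel_compl_ball hK hs hLam hε)).mul_of_top_right
        (hDL.comp_measurePreserving (measurePreserving_add_left volume x₀))
    refine h1.congr (Eventually.of_forall fun y => ?_)
    by_cases hy : y ∈ Metric.ball (0 : Space d) ε
    · simp only [hD1 _ ((hball y).2 hy), zero_mul]
    · simp only [indicator_of_mem (show y ∈ (Metric.ball (0 : Space d) ε)ᶜ from hy)]
  have hfd : fderiv ℝ v x₀ = M • fderiv ℝ b x₀ := by
    have h1 : v =ᶠ[𝓝 x₀] fun z => M * b z + c₀ := by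
      filter_upwards [Metric.ball_mem_nhds x₀ hε] with z hz using hv1 z hz
    rw [h1.fderiv_eq, fderiv_add_const, fderiv_const_mul (hb.differentiable x₀)]
  have hδ : ∀ y, delta s v x₀ y = M * delta s b x₀ y + D (x₀ + y) := by
    intro y
    have h0 := hv1 x₀ (Metric.mem_ball_self hε)
    simp only [delta, D, hfd, h0]
    split_ifs
    · ring
    · by_cases hy : y ∈ Metric.ball (0 : Space d) 1
      · simp only [indicator_of_mem hy, _root_.smul_apply, smul_eq_mul]; ring
      · simp only [indicator_of_notMem hy]; ring
    · simp only [_root_.smul_apply, smul_eq_mul]; ring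
  have hsplit : nonlocalOperator s K v x₀
      = M * nonlocalOperator s K b x₀ + ∫ y, D (x₀ + y) * K y := by
    unfold nonlocalOperator
    rw [← integral_const_mul, ← integral_add (hbi.const_mul M) hDK]
    congr 1; ext y
    rw [hδ]; ring
  have hwW : Integrable (fun x => w x * W x) volume := integrable_mul_tailWeight hs hR hw
  have hbW : Integrable (fun x => b x * W x) volume :=
    integrable_mul_tailWeight hs hR hb.memLp
  have hDW : Integrable (fun x => D x * W x) volume := integrable_mul_tailWeight hs hR hDL
  have h1 : lam * ∫ z, D z * W z ≤ ∫ y, D (x₀ + y) * K y := by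
    rw [← integral_add_left_eq_self (fun z => D z * W z) x₀, ← integral_const_mul]
    refine integral_mono ((hDW.comp_add_left x₀).const_mul lam) hDK fun y => ?_
    change lam * (D (x₀ + y) * W (x₀ + y)) ≤ D (x₀ + y) * K y
    by_cases hy : y = 0
    · subst hy
      rw [hD1 _ (by simpa using hε)]; simp
    · calc _ = D (x₀ + y) * (lam * W (x₀ + y)) := by ring
        _ ≤ _ := mul_le_mul_of_nonneg_left
          (tailWeight_le_kernel hK hs hlam hρ hρR hx₀ hy) (hD0 _)
  -- Outside the ball c₀ ≤ 0 gives D ≥ w - M b. Inside, D = 0 and the w-part is subtracted again,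
  -- leaving -M b ≤ 0.
  have h2 : (∫ x, w x * W x) - M * (∫ x, b x * W x) - ∫ x in Metric.ball x₀ ε, w x * W x
      ≤ ∫ z, D z * W z := by
    have hi : Integrable ((Metric.ball x₀ ε).indicator fun x => w x * W x) volume :=
      hwW.indicator measurableSet_ball
    have hi' : Integrable (fun x => w x * W x - M * (b x * W x)) volume :=
      hwW.sub (hbW.const_mul M)
    rw [← integral_indicator measurableSet_ball, ← integral_const_mul,
      ← integral_sub hwW (hbW.const_mul M), ← integral_sub hi' hi]
    refine integral_mono (hi'.sub hi) hDW fun z => ?_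
    have hWz : 0 ≤ W z := (tailWeight_pos hR z).le
    have hbz : 0 ≤ M * (b z * W z) := mul_nonneg hM (mul_nonneg (hb.nonneg z) hWz)
    by_cases hz : z ∈ Metric.ball x₀ ε
    · simp only [indicator_of_mem hz, hD1 z hz]
      linarith
    · simp only [indicator_of_notMem hz, hD2 z hz, G]
      nlinarith
  rw [hsplit]
  have := mul_le_mul_of_nonneg_left h2 hlam.le
  linarith

/-! ### Reduction to zero right-hand side -/

lemma measurableSet_timeInterval (s R : ℝ) : MeasurableSet (timeInterval s R) := measurableSet_Ioc

lemma pucciInf_add_const (w : Space d → ℝ) (c : ℝ) (x : Space d) :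
    pucciInf s lam Lam ρ (fun z => w z + c) x = pucciInf s lam Lam ρ w x := by
  have : ∀ y, delta s (fun z => w z + c) x y = delta s w x y := by
    intro y
    simp only [delta, fderiv_add_const, add_sub_add_right_eq_sub]
  simp only [pucciInf, nonlocalOperator, this]

/-- Adding `κ (t + T₀)` turns a supersolution with right-hand side `-κ` into one with right-hand
side `0`. -/
lemma IsViscositySupersolution.add_linear {R κ T₀ : ℝ} {Ω : Set (Space d)} {u : Space d → ℝ → ℝ}
    (hu : IsViscositySupersolution (pucciInf s lam Lam ρ) (fun _ _ => -κ) Ω (timeInterval s R) u) :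
    IsViscositySupersolution (pucciInf s lam Lam ρ) (fun _ _ => 0) Ω (timeInterval s R)
      (fun x t => u x t + κ * (t + T₀)) where
  bounded := by
    refine ⟨hu.bounded.memLp.add (memLp_top_of_bound (C := |κ| * (R ^ (2 * s) + |T₀|)) ?_ ?_),
      fun t ht => (hu.bounded.memLp_slice t ht).add (memLp_top_const _)⟩
    · exact (by fun_prop : Continuous fun p : Space d × ℝ => κ * (p.2 + T₀)).aestronglyMeasurable
    · refine ae_restrict_of_forall_mem
        (MeasurableSet.univ.prod (measurableSet_timeInterval s R)) fun p hp => ?_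
      rw [norm_mul, Real.norm_eq_abs, Real.norm_eq_abs]
      have h1 : |p.2| ≤ R ^ (2 * s) := by
        rw [abs_of_nonpos hp.2.2]
        linarith [hp.2.1]
      have := abs_add_le p.2 T₀
      gcongr
      linarith
  lsc := by
    refine hu.lsc.add ((Continuous.lowerSemicontinuous ?_).lowerSemicontinuousOn _)
    fun_prop
  test := by
    intro x₀ hx₀ t₀ ht₀ ε hε hsub φ hφ h0 hle
    have hφ' : IsTestFunction x₀ t₀ ε (fun x t => φ x t - κ * (t + T₀)) := by
      refine ⟨fun x hx t ht => (hφ.left_differentiable x hx t ht).sub (by fun_prop),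
        fun t ht x hx => (hφ.differentiable_space t ht x hx).sub_const _, fun t ht => ?_⟩
      obtain ⟨C, hC⟩ := hφ.lipschitz_gradient t ht
      exact ⟨C, by simpa only [fderiv_sub_const] using hC⟩
    have key := hu.test x₀ hx₀ t₀ ht₀ ε hε hsub _ hφ' (by simp [← h0])
      (fun x hx t ht => by have := hle x hx t ht; linarith)
    have hg : ∀ x t, glue x₀ t₀ ε (fun x t => φ x t - κ * (t + T₀)) u x t
        = glue x₀ t₀ ε φ (fun x t => u x t + κ * (t + T₀)) x t + -(κ * (t + T₀)) := by
      intro x t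
      unfold glue
      split_ifs <;> ring
    simp only [hg] at key
    rw [pucciInf_add_const] at key
    have ht₀' : t₀ ∈ Ioc (t₀ - ε) t₀ := ⟨by linarith, le_rfl⟩
    have hx₀' : x₀ ∈ Metric.ball x₀ ε := Metric.mem_ball_self hε
    have hev : (fun t => glue x₀ t₀ ε φ (fun x t => u x t + κ * (t + T₀)) x₀ t)
        =ᶠ[𝓝[Iic t₀] t₀] fun t => φ x₀ t := by
      filter_upwards [Ioc_mem_nhdsLE (show t₀ - ε < t₀ by linarith)] with t ht
      simp [glue, hx₀', ht.1, ht.2]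
    have hd : DifferentiableWithinAt ℝ
        (fun t => glue x₀ t₀ ε φ (fun x t => u x t + κ * (t + T₀)) x₀ t) (Iic t₀) t₀ :=
      (hφ.left_differentiable x₀ hx₀' t₀ ht₀').congr_of_eventuallyEq hev
        (hev.eq_of_nhdsWithin self_mem_Iic)
    have hlin : HasDerivWithinAt (fun t : ℝ => -(κ * (t + T₀))) (-(κ * 1)) (Iic t₀) t₀ :=
      ((((hasDerivAt_id t₀).add_const T₀).const_mul κ).neg).hasDerivWithinAt
    have hder : leftDeriv (fun t => glue x₀ t₀ ε φ (fun x t => u x t + κ * (t + T₀)) x₀ t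
        + -(κ * (t + T₀))) t₀
        = leftDeriv (fun t => glue x₀ t₀ ε φ (fun x t => u x t + κ * (t + T₀)) x₀ t) t₀ - κ := by
      have := (hd.hasDerivWithinAt.add hlin).derivWithin (uniqueDiffWithinAt_Iic t₀)
      rw [mul_one, ← sub_eq_add_neg] at this
      exact this
    rw [hder] at key
    generalize leftDeriv (fun t => glue x₀ t₀ ε φ (fun x t => u x t + κ * (t + T₀)) x₀ t) t₀ = D
      at key ⊢
    generalize pucciInf s lam Lam ρ
      (fun x => glue x₀ t₀ ε φ (fun x t => u x t + κ * (t + T₀)) x t₀) x₀ = P at key ⊢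
    -- In the extended reals, subtracting ⊥ gives ⊤, so that case is trivial; subtracting ⊤ gives ⊥,
    -- which contradicts `key`.
    induction P with
    | bot => simp
    | top => simp at key
    | coe P =>
      norm_cast at key ⊢
      linarith

/-! ### The weighted mass at a touching time -/

/-- The weighted mass `∫ w(x) (R + |x|)^{-d-2s} dx`. -/
noncomputable def tailMass (s R : ℝ) (w : Space d → ℝ) : ℝ := ∫ x, w x * tailWeight d s R x

lemma tailMass_nonneg {R : ℝ} (hR : 0 < R) {w : Space d → ℝ} (hw : ∀ x, 0 ≤ w x) :
    0 ≤ tailMass s R w :=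
  integral_nonneg fun x => mul_nonneg (hw x) (tailWeight_pos hR x).le

lemma integrableOn_tailMass (hs : 0 < s) {R : ℝ} (hR : 0 < R) {u : Space d → ℝ → ℝ}
    (hu : IsBoundedOnStrip (timeInterval s R) u) :
    IntegrableOn (fun t => tailMass s R fun x => u x t) (timeInterval s R) volume := by
  have hfin : IsFiniteMeasure (volume.restrict (timeInterval s R)) :=
    ⟨by rw [Measure.restrict_apply_univ]; exact measure_Ioc_lt_top⟩
  have h1 : Integrable (fun p : Space d × ℝ => tailWeight d s R p.1 * 1)
      (volume.prod (volume.restrict (timeInterval s R))) :=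
    (integrable_tailWeight hs hR).mul_prod (integrable_const (1 : ℝ))
  have hm := hu.memLp
  rw [Measure.volume_eq_prod, ← Measure.prod_restrict, Measure.restrict_univ] at hm
  have h2 : Integrable (fun p : Space d × ℝ => u p.1 p.2 * (tailWeight d s R p.1 * 1))
      (volume.prod (volume.restrict (timeInterval s R))) := h1.mul_of_top_right hm
  simp only [mul_one] at h2
  exact h2.integral_prod_right

/-- The viscosity inequality at a point where `u` is touched from below by a barrier that is affine
in time and in a cutoff function. -/
lemma tailMass_le_of_touching (hd : 1 ≤ d) (hs : 0 < s) (hlam : 0 < lam) (hLam : 0 < Lam) {L C : ℝ}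
    (hC : ∀ (ρ R : ℝ) (K b : Space d → ℝ) (x : Space d), 0 < R →
      IsAdmissibleKernel s lam Lam ρ K → IsCutoff L R b →
      Integrable (fun y => delta s b x y * K y) volume ∧
        |nonlocalOperator s K b x| ≤ C * R ^ (-(2 * s)))
    {R : ℝ} (hρ : 0 ≤ ρ) (hρR : ρ < R) {b : Space d → ℝ} (hb : IsCutoff L R b)
    {u : Space d → ℝ → ℝ}
    (hu : IsViscositySupersolution (pucciInf s lam Lam ρ) (fun _ _ => 0)
      (Metric.ball 0 R) (timeInterval s R) u)
    {x₀ : Space d} (hx₀ : ‖x₀‖ < R) {t₀ T : ℝ} (ht₀ : t₀ ≤ 0) (hT : -(R ^ (2 * s)) < T)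
    (hTt : T < t₀) {g M e c₀ : ℝ} (hg : 0 ≤ g) (hM : 0 ≤ M) (hc₀ : c₀ ≤ 0)
    (htouch : M * b x₀ + c₀ = u x₀ t₀) (hle : ∀ x, M * b x + c₀ ≤ u x t₀)
    (hbelow : ∀ x, ∀ t ∈ Ioc T t₀, (M - g * (t₀ - t)) * b x + c₀ + e * (t₀ - t) ≤ u x t) :
    lam * tailMass s R (fun x => u x t₀) ≤
      g + (C + lam * (volume (Metric.ball (0 : Space d) 1)).toReal) * R ^ (-(2 * s)) * M - e := by
  by_contra! hcon
  have hR : 0 < R := hρ.trans_lt hρR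
  set V := (volume (Metric.ball (0 : Space d) 1)).toReal
  have ht₀I : t₀ ∈ timeInterval s R := ⟨by linarith, ht₀⟩
  have hslice := hu.bounded.memLp_slice t₀ ht₀I
  have hint := integrable_mul_tailWeight (R := R) hs hR hslice
  have : Nontrivial (Space d) := by
    have : Nonempty (Fin d) := ⟨⟨0, hd⟩⟩
    infer_instance
  -- Gluing loses the mass of u in B_ε(x₀). By absolute continuity of the integral this tends to 0,
  -- so for small ε it is less than the gap in the negated, strict inequality.
  have hlim : Tendsto (fun ε : ℝ => lam * ∫ x in Metric.ball x₀ ε, u x t₀ * tailWeight d s R x)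
      (𝓝[>] 0) (𝓝 (lam * 0)) := by
    refine (hint.tendsto_setIntegral_nhds_zero ?_).const_mul lam
    have h1 : Tendsto (fun ε : ℝ => ENNReal.ofReal (ε ^ Module.finrank ℝ (Space d))
        * volume (Metric.ball (0 : Space d) 1)) (𝓝[>] 0) (𝓝 (ENNReal.ofReal (0 ^ d)
          * volume (Metric.ball (0 : Space d) 1))) := by
      refine ENNReal.Tendsto.mul_const ?_ (Or.inr measure_ball_lt_top.ne)
      refine (ENNReal.continuous_ofReal.tendsto _).comp ?_
      rw [finrank_euclideanSpace_fin]
      exact ((continuous_pow d).tendsto' (0 : ℝ) _ rfl).mono_left nhdsWithin_le_nhds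
    rw [zero_pow (by omega), ENNReal.ofReal_zero, zero_mul] at h1
    refine h1.congr' ?_
    filter_upwards [self_mem_nhdsWithin] with ε hε
    exact (Measure.addHaar_ball_of_pos volume x₀ hε).symm
  rw [mul_zero] at hlim
  have hev := hlim.eventually_lt_const (sub_pos.2 hcon)
  have hε1 : ∀ᶠ ε : ℝ in 𝓝[>] 0, ε < min (R - ‖x₀‖) (t₀ - T) :=
    (eventually_lt_nhds (lt_min (sub_pos.2 hx₀) (sub_pos.2 hTt))).filter_mono nhdsWithin_le_nhds
  obtain ⟨ε, ⟨hε2, hε1⟩, hε⟩ := ((hev.and hε1).and self_mem_nhdsWithin).exists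
  replace hε : 0 < ε := hε
  have hεR := hε1.trans_le (min_le_left _ _)
  have hεT := hε1.trans_le (min_le_right _ _)
  let φ : Space d → ℝ → ℝ := fun x t => (M - g * (t₀ - t)) * b x + c₀ + e * (t₀ - t)
  have hφ : IsTestFunction x₀ t₀ ε φ := by
    have hfd : ∀ t x, HasFDerivAt (fun z => φ z t) ((M - g * (t₀ - t)) • fderiv ℝ b x) x := by
      intro t x
      exact (((hb.differentiable x).hasFDerivAt.const_mul _).add_const _).add_const _
    refine ⟨fun x _ t _ => ?_, fun t _ x _ => (hfd t x).differentiableAt, fun t _ => ?_⟩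
    · exact (by fun_prop : DifferentiableAt ℝ
        (fun t => (M - g * (t₀ - t)) * b x + c₀ + e * (t₀ - t)) t).differentiableWithinAt
    · refine ⟨(|M - g * (t₀ - t)| * |L / R ^ 2|).toNNReal, ?_⟩
      refine LipschitzOnWith.of_dist_le_mul fun x _ y _ => ?_
      rw [(hfd t x).fderiv, (hfd t y).fderiv, dist_eq_norm, dist_eq_norm, ← smul_sub, norm_smul,
        Real.norm_eq_abs, Real.coe_toNNReal _ (by positivity), mul_assoc]
      gcongr
      exact (hb.fderiv_sub_le x y).trans (by gcongr; exact le_abs_self _)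
  have hsub : Metric.ball x₀ ε ×ˢ Ioc (t₀ - ε) t₀ ⊆ Metric.ball 0 R ×ˢ timeInterval s R := by
    refine prod_mono (Metric.ball_subset_ball' ?_) (Ioc_subset_Ioc (by linarith) ht₀)
    rw [dist_zero_right]; linarith
  have key := hu.test x₀ (by simpa using hx₀) t₀ ht₀I ε hε hsub φ hφ (by simp [φ, htouch])
    (fun x _ t ht => hbelow x t ⟨by linarith [ht.1], ht.2⟩)
  have hx₀' : x₀ ∈ Metric.ball x₀ ε := Metric.mem_ball_self hε
  have hder : leftDeriv (fun t => glue x₀ t₀ ε φ u x₀ t) t₀ = g * b x₀ - e := by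
    have hev : (fun t => glue x₀ t₀ ε φ u x₀ t) =ᶠ[𝓝[Iic t₀] t₀] fun t => φ x₀ t := by
      filter_upwards [Ioc_mem_nhdsLE (show t₀ - ε < t₀ by linarith)] with t ht
      simp [glue, hx₀', ht.1, ht.2]
    have h1 : HasDerivAt (fun t => φ x₀ t) (g * b x₀ - e) t₀ := by
      have h2 : HasDerivAt (fun t : ℝ => t₀ - t) (-1) t₀ := (hasDerivAt_id t₀).const_sub t₀
      have h3 := ((((h2.const_mul g).const_sub M).mul_const (b x₀)).add_const c₀).add
        (h2.const_mul e)
      exact h3.congr_deriv (by ring)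
    rw [leftDeriv, hev.derivWithin_eq (hev.eq_of_nhdsWithin self_mem_Iic)]
    exact h1.hasDerivWithinAt.derivWithin (uniqueDiffWithinAt_Iic t₀)
  rw [hder] at key
  set B : ℝ := lam * tailMass s R (fun x => u x t₀) - (C + lam * V) * R ^ (-(2 * s)) * M
    - lam * ∫ x in Metric.ball x₀ ε, u x t₀ * tailWeight d s R x with hB
  -- The lower bound B is the same for all admissible kernels, so it passes to the infimum, also
  -- when the class is empty.
  have hP : (B : EReal) ≤ pucciInf s lam Lam ρ (fun x => glue x₀ t₀ ε φ u x t₀) x₀ := by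
    refine le_iInf₂ fun K hK => EReal.coe_le_coe_iff.2 ?_
    obtain ⟨hbi, hbb⟩ := hC ρ R K b x₀ hR hK hb
    have h1 := le_nonlocalOperator_glued hK hs hlam hLam hρ hρR hb hx₀ hbi hslice hε hM hc₀
      (v := fun x => glue x₀ t₀ ε φ u x t₀)
      (fun z hz => by simp [glue, φ, Metric.mem_ball.1 hz, hε])
      (fun z hz => by rw [glue, if_neg (fun h => hz h.1)]) hle
    refine le_trans ?_ h1
    have h2 := mul_le_mul_of_nonneg_left (abs_le.1 hbb).1 hM
    have h3 := mul_le_mul_of_nonneg_left (integral_cutoff_tailWeight_le hs hR hb)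
      (mul_nonneg hlam.le hM)
    rw [hB, tailMass]
    linarith
  have h4 : ((0 : ℝ) : EReal) ≤ ((g * b x₀ - e : ℝ) : EReal) - (B : EReal) :=
    key.trans (EReal.sub_le_sub le_rfl hP)
  norm_cast at h4
  have h5 : g * b x₀ ≤ g := mul_le_of_le_one_right hg (hb.le_one x₀)
  linarith

/-! ### The barrier on short time intervals -/

/-- On short time intervals, `u` is bounded below in `B_{R/2}` by the accumulated mass. -/
lemma exists_short_time_bound (hd : 1 ≤ d) (hs0 : 0 < s) (hs1 : s < 1) (hlam : 0 < lam)
    (hLam : 0 < Lam) :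
    ∃ C : ℝ, 0 < C ∧ ∀ (ρ R : ℝ), 0 ≤ ρ → ρ < R → ∀ u : Space d → ℝ → ℝ,
      (∀ x, ∀ t ∈ timeInterval s R, 0 ≤ u x t) →
      IsViscositySupersolution (pucciInf s lam Lam ρ) (fun _ _ => 0)
        (Metric.ball 0 R) (timeInterval s R) u →
      ∀ T T₁ : ℝ, -(R ^ (2 * s)) < T → T ≤ T₁ → T₁ ≤ 0 →
      C * R ^ (-(2 * s)) * (T₁ - T) ≤ 1 / 2 → ∀ x : Space d, ‖x‖ < R / 2 →
      lam / 2 * ∫ t in Ioc T T₁, tailMass s R (fun x => u x t) ≤ u x T₁ := by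
  obtain ⟨L, hL, hcut⟩ := exists_isCutoff d
  obtain ⟨C, hC0, hC⟩ := exists_nonlocalOperator_cutoff_bound d hs0 hs1 lam hLam hL
  set V := (volume (Metric.ball (0 : Space d) 1)).toReal with hV
  have hV0 : 0 < V :=
    ENNReal.toReal_pos (Metric.measure_ball_pos _ _ one_pos).ne' measure_ball_lt_top.ne
  refine ⟨C + lam * V, by positivity, ?_⟩
  intro ρ R hρ hρR u hu0 hu T T₁ hT hTT hT₁ hshort x hx
  have hR : 0 < R := hρ.trans_lt hρR
  obtain ⟨b, hb⟩ := hcut R hR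
  have hsubI : Icc T T₁ ⊆ timeInterval s R := fun t ht => ⟨by linarith [ht.1], ht.2.trans hT₁⟩
  set F : ℝ → ℝ := fun t => tailMass s R fun x => u x t with hF
  have hF0 : ∀ t ∈ Icc T T₁, 0 ≤ F t := fun t ht => tailMass_nonneg hR fun x => hu0 x t (hsubI ht)
  have hFint : IntegrableOn F (Ioc T T₁) volume :=
    (integrableOn_tailMass hs0 hR hu.bounded).mono_set (Ioc_subset_Icc_self.trans hsubI)
  have hFnn : ∀ t ∈ Ioc T T₁, ((F t).toNNReal : ℝ) = F t :=
    fun t ht => Real.coe_toNNReal _ (hF0 t (Ioc_subset_Icc_self ht))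
  have hFint' : Integrable (fun t => ((F t).toNNReal : ℝ)) (volume.restrict (Ioc T T₁)) :=
    hFint.congr (ae_restrict_of_forall_mem measurableSet_Ioc fun t ht => (hFnn t ht).symm)
  have hFeq : ∫ t in Ioc T T₁, ((F t).toNNReal : ℝ) = ∫ t in Ioc T T₁, F t :=
    setIntegral_congr_fun measurableSet_Ioc hFnn
  -- it suffices to prove the bound up to an arbitrarily small error
  suffices h : ∀ δ : ℝ, 0 < δ →
      lam / 2 * ((∫ t in Ioc T T₁, F t) - δ) - δ * (T₁ - T) ≤ u x T₁ by
    have hl : Tendsto (fun δ : ℝ => lam / 2 * ((∫ t in Ioc T T₁, F t) - δ) - δ * (T₁ - T))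
        (𝓝[>] 0) (𝓝 (lam / 2 * ((∫ t in Ioc T T₁, F t) - 0) - 0 * (T₁ - T))) :=
      ((by fun_prop : Continuous fun δ : ℝ =>
        lam / 2 * ((∫ t in Ioc T T₁, F t) - δ) - δ * (T₁ - T)).tendsto 0).mono_left
        nhdsWithin_le_nhds
    have := le_of_tendsto hl (eventually_nhdsWithin_of_forall fun δ hδ => h δ hδ)
    simpa using this
  intro δ hδ
  -- F is merely integrable in time. An upper semicontinuous minorant G, losing at most δ of the
  -- integral, controls the growth of m just before a given time by the value of G at that time.
  obtain ⟨G, hGF, hGusc, hGint, hGle⟩ :=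
    exists_upperSemicontinuous_le_integral_le (fun t => (F t).toNNReal) hFint' hδ
  rw [hFeq] at hGle
  set g : ℝ → ℝ := (Ioc T T₁).indicator fun t => (G t : ℝ) with hg
  have hgint : Integrable g volume := (integrable_indicator_iff measurableSet_Ioc).2 hGint
  have hg0 : ∀ t, 0 ≤ g t := fun t => indicator_nonneg (fun _ _ => NNReal.coe_nonneg _) t
  have hgG : ∀ t, g t ≤ G t := fun t => indicator_le_self' (fun _ _ => NNReal.coe_nonneg _) t
  have hgii : ∀ a b : ℝ, IntervalIntegrable g volume a b := fun a b => hgint.intervalIntegrable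
  set m : ℝ → ℝ := fun t => lam * ∫ τ in T..t, g τ with hm
  have hmcont : Continuous m := (intervalIntegral.continuous_primitive hgii T).const_mul lam
  have hmsub : ∀ t t', m t' - m t = lam * ∫ τ in t..t', g τ := fun t t' => by
    rw [hm, ← mul_sub, intervalIntegral.integral_interval_sub_left (hgii _ _) (hgii _ _)]
  have hmT : m T = 0 := by simp [hm]
  have hmmono : ∀ t t', t ≤ t' → m t ≤ m t' := fun t t' h => by
    have := hmsub t t'
    have h2 : 0 ≤ lam * ∫ τ in t..t', g τ :=
      mul_nonneg hlam.le (intervalIntegral.integral_nonneg h fun _ _ => hg0 _)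
    linarith
  have hm1 : lam * ((∫ t in Ioc T T₁, F t) - δ) ≤ m T₁ := by
    refine mul_le_mul_of_nonneg_left (hGle.trans_eq ?_) hlam.le
    rw [intervalIntegral.integral_of_le hTT]
    exact (setIntegral_congr_fun (g := fun t => (G t : ℝ)) measurableSet_Ioc
      fun t ht => indicator_of_mem ht _).symm
  -- The slope e beats the error (C + λV) R^{-2s} m(t) for every t ≤ T₁, because m is nondecreasing,
  -- with δ to spare.
  set e : ℝ := (C + lam * V) * R ^ (-(2 * s)) * m T₁ + δ with he
  have hmT₁ : 0 ≤ m T₁ := hmT ▸ hmmono T T₁ hTT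
  have he0 : 0 ≤ e := by positivity
  have hmain : ∀ x, ∀ t ∈ Icc T T₁, ‖x‖ ≤ 3 * R / 4 → m t * b x - e * (t - T) ≤ u x t := by
    set S := Metric.closedBall (0 : Space d) (3 * R / 4) ×ˢ Icc T T₁ with hS
    have hScomp : IsCompact S := (isCompact_closedBall _ _).prod isCompact_Icc
    have hSne : S.Nonempty := ⟨(0, T), by simp; positivity, left_mem_Icc.2 hTT⟩
    have hSsub : S ⊆ Metric.ball 0 R ×ˢ timeInterval s R :=
      prod_mono (Metric.closedBall_subset_ball (by linarith)) hsubI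
    have hcont : LowerSemicontinuous fun p : Space d × ℝ => -(m p.2 * b p.1 - e * (p.2 - T)) := by
      have := hb.contDiff.continuous
      exact Continuous.lowerSemicontinuous (by fun_prop)
    obtain ⟨⟨x₀, t₀⟩, hp, hmin⟩ := LowerSemicontinuousOn.exists_isMinOn hSne hScomp
      ((hu.lsc.mono hSsub).add (hcont.lowerSemicontinuousOn S))
    rw [isMinOn_iff] at hmin
    set μ := u x₀ t₀ + -(m t₀ * b x₀ - e * (t₀ - T)) with hμ
    obtain ⟨hx₀, ht₀⟩ : x₀ ∈ Metric.closedBall (0 : Space d) (3 * R / 4) ∧ t₀ ∈ Icc T T₁ := hp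
    have hx₀' : ‖x₀‖ ≤ 3 * R / 4 := by simpa using hx₀
    have hmin' : ∀ x, ∀ t ∈ Icc T T₁, ‖x‖ ≤ 3 * R / 4 → m t * b x - e * (t - T) + μ ≤ u x t := by
      intro x t ht hx
      have : μ ≤ u x t + -(m t * b x - e * (t - T)) := hmin (x, t) ⟨by simpa using hx, ht⟩
      linarith
    rcases le_or_gt 0 μ with hμ0 | hμ0
    · intro x t ht hx
      linarith [hmin' x t ht hx]
    exfalso
    -- A negative minimum μ extends the touching to all of space: where b = 0 the shifted barrier is
    -- negative, while u ≥ 0.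
    have hglob : ∀ x, ∀ t ∈ Icc T T₁, m t * b x - e * (t - T) + μ ≤ u x t := by
      intro x t ht
      rcases le_total ‖x‖ (3 * R / 4) with h | h
      · exact hmin' x t ht h
      · rw [hb.eq_zero x h]
        have := mul_nonneg he0 (sub_nonneg.2 ht.1)
        linarith [hu0 x t (hsubI ht)]
    -- At time T the barrier is zero, so the difference there is u ≥ 0 and cannot be the negative
    -- minimum.
    have hTt₀ : T < t₀ := by
      refine lt_of_le_of_ne ht₀.1 fun h => ?_
      have h1 := hu0 x₀ t₀ (hsubI ht₀)
      rw [hμ, ← h, hmT] at hμ0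
      rw [← h] at h1
      simp at hμ0
      linarith
    set δ' := δ / (2 * lam) with hδ'
    have hδ'0 : 0 < δ' := by positivity
    obtain ⟨T', hT't, hT'⟩ : ∃ T' < t₀, ∀ t ∈ Ioc T' t₀, (G t : ℝ) < G t₀ + δ' := by
      have h1 : ∀ᶠ t in 𝓝 t₀, G t < G t₀ + δ'.toNNReal :=
        hGusc t₀ _ (lt_add_of_pos_right _ (Real.toNNReal_pos.2 hδ'0))
      obtain ⟨l, hl, hl'⟩ := exists_Ioc_subset_of_mem_nhds h1 (exists_lt t₀)
      refine ⟨l, hl, fun t ht => ?_⟩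
      have h2 : G t < G t₀ + δ'.toNNReal := hl' ht
      have h3 : (G t : ℝ) < ((G t₀ + δ'.toNNReal : ℝ≥0) : ℝ) := NNReal.coe_lt_coe.2 h2
      rwa [NNReal.coe_add, Real.coe_toNNReal _ hδ'0.le] at h3
    -- Since m need not be differentiable at t₀, it is replaced by the line of slope λ(G(t₀) + δ'),
    -- which lies below m just before t₀.
    have hbelow : ∀ x, ∀ t ∈ Ioc (max T T') t₀,
        (m t₀ - lam * (G t₀ + δ') * (t₀ - t)) * b x + (μ - e * (t₀ - T)) + e * (t₀ - t)
          ≤ u x t := by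
      intro x t ht
      have htT : T < t := (le_max_left _ _).trans_lt ht.1
      have htT' : T' < t := (le_max_right _ _).trans_lt ht.1
      have h1 : ∫ τ in t..t₀, g τ ≤ (G t₀ + δ') * (t₀ - t) := by
        have h2 := intervalIntegral.integral_mono_on ht.2 (hgii t t₀)
          (intervalIntegrable_const (c := (G t₀ + δ' : ℝ)))
          (fun τ hτ => (hgG τ).trans (hT' τ ⟨htT'.trans_le hτ.1, hτ.2⟩).le)
        rwa [intervalIntegral.integral_const, smul_eq_mul, mul_comm] at h2
      have h3 := mul_le_mul_of_nonneg_left h1 hlam.le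
      have h4 := hmsub t t₀
      have h5 : m t₀ - lam * (G t₀ + δ') * (t₀ - t) ≤ m t := by linarith
      have h6 := mul_le_mul_of_nonneg_right h5 (hb.nonneg x)
      have h7 := hglob x t ⟨htT.le, ht.2.trans ht₀.2⟩
      linarith
    have htouch := tailMass_le_of_touching hd hs0 hlam hLam hC hρ hρR hb hu (x₀ := x₀) (t₀ := t₀)
      (T := max T T') (g := lam * (G t₀ + δ')) (M := m t₀) (e := e) (c₀ := μ - e * (t₀ - T))
      (by linarith) (ht₀.2.trans hT₁) (hT.trans_le (le_max_left _ _)) (max_lt hTt₀ hT't)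
      (by positivity) (hmT ▸ hmmono T t₀ ht₀.1)
      (by linarith [mul_nonneg he0 (sub_nonneg.2 ht₀.1)]) (by rw [hμ]; ring)
      (fun x => by linarith [hglob x t₀ ht₀]) hbelow
    -- The inequality at the touching point now reads λ F(t₀) ≤ λ G(t₀) + δ/2 - δ at best, against G
    -- ≤ F.
    have h1 : (G t₀ : ℝ) ≤ F t₀ :=
      (NNReal.coe_le_coe.2 (hGF t₀)).trans_eq (hFnn t₀ ⟨hTt₀, ht₀.2⟩)
    have h2 : (C + lam * V) * R ^ (-(2 * s)) * m t₀ ≤ (C + lam * V) * R ^ (-(2 * s)) * m T₁ :=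
      mul_le_mul_of_nonneg_left (hmmono _ _ ht₀.2) (by positivity)
    have h3 : lam * δ' = δ / 2 := by rw [hδ']; field_simp
    have h4 := mul_le_mul_of_nonneg_left h1 hlam.le
    change lam * F t₀ ≤ _ at htouch
    linarith
  have hfin := hmain x T₁ (right_mem_Icc.2 hTT) (by linarith)
  rw [hb.eq_one x hx.le, mul_one] at hfin
  -- Shortness of the interval makes the loss e (T₁ - T) at most m(T₁)/2 + δ (T₁ - T).
  have h1 := mul_le_mul_of_nonneg_right hshort hmT₁
  have h2 : e * (T₁ - T) = (C + lam * V) * R ^ (-(2 * s)) * (T₁ - T) * m T₁ + δ * (T₁ - T) := by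
    rw [he]; ring
  linarith

/-! ### From short to long times -/

/-- Iteration of a short-time lower bound: if `h` dominates the integral of `F` over short
intervals and `F` dominates `h`, then `h` dominates the integral of `F` over long intervals. -/
lemma exists_long_time_bound {α β : ℝ} (hα : 0 < α) (hβ : 0 < β) (n : ℕ) :
    ∃ c : ℝ, 0 < c ∧ ∀ (F : ℝ → ℝ) (P : ℝ → ℝ → Prop) (τ T T₂ : ℝ), 0 < τ →
      IntegrableOn F (Ioc T T₂) volume → (∀ t ∈ Ioc T T₂, 0 ≤ F t) →
      (∀ t h h', h ≤ h' → P t h' → P t h) →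
      (∀ t t', T ≤ t → t ≤ t' → t' ≤ T₂ → t' - t ≤ τ → P t' (α * ∫ r in Ioc t t', F r)) →
      (∀ t h, t ∈ Ioc T T₂ → 0 ≤ h → P t h → β / τ * h ≤ F t) →
      ∀ t, T ≤ t → t ≤ T₂ → t - T ≤ n * (τ / 2) → P t (c * ∫ r in Ioc T t, F r) := by
  induction n with
  | zero =>
    refine ⟨α, hα, fun F P τ T T₂ hτ hF hF0 hPm hP hPF t ht ht' htn => ?_⟩
    simp at htn
    exact hP T t le_rfl ht ht' (by linarith)
  | succ n ih =>
    obtain ⟨c, hc, ih⟩ := ih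
    set c' := min (α / 2) (α * β * c / 4) with hc'
    have hc1 : c' ≤ α / 2 := min_le_left _ _
    have hc2 : c' ≤ α * β * c / 4 := min_le_right _ _
    refine ⟨c', by positivity, fun F P τ T T₂ hτ hF hF0 hPm hP hPF t ht ht' htn => ?_⟩
    have hnn : ∀ a b, T ≤ a → b ≤ T₂ → 0 ≤ ∫ r in Ioc a b, F r := fun a b ha hb =>
      setIntegral_nonneg measurableSet_Ioc fun r hr => hF0 r ⟨ha.trans_lt hr.1, hr.2.trans hb⟩
    have hA := hnn T t le_rfl ht'
    rcases le_or_gt (t - T) τ with h1 | h1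
    · refine hPm t _ _ (mul_le_mul_of_nonneg_right (b := c') (c := α) ?_ hA)
        (hP T t le_rfl ht ht' h1)
      linarith
    have hint : ∀ a b, T ≤ a → b ≤ T₂ → IntegrableOn F (Ioc a b) volume := fun a b ha hb =>
      hF.mono_set (Ioc_subset_Ioc ha hb)
    have hsplit : ∫ r in Ioc T t, F r
        = (∫ r in Ioc T (t - τ), F r) + ∫ r in Ioc (t - τ) t, F r := by
      rw [← setIntegral_union (by
          rw [Set.disjoint_left]; intro r hr hr'; exact absurd hr.2 (not_le.2 hr'.1))
        measurableSet_Ioc (hint _ _ le_rfl (by linarith)) (hint _ _ (by linarith) ht'),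
        Ioc_union_Ioc_eq_Ioc (by linarith) (by linarith)]
    have hlast := hP (t - τ) t (by linarith) (by linarith) ht' (by linarith)
    refine hPm t _ _ ?_ hlast
    set A := ∫ r in Ioc T t, F r
    set A₁ := ∫ r in Ioc T (t - τ), F r with hA₁
    set A₂ := ∫ r in Ioc (t - τ) t, F r with hA₂
    have hA₁0 : 0 ≤ A₁ := hnn _ _ le_rfl (by linarith)
    -- Either the last interval of length τ carries at least half of the integral and the short-time
    -- bound suffices, or the earlier part A₁ does. In the second case the induction hypothesis,
    -- valid up to t - τ/2, gives F ≥ (β/τ) c A₁ on the first half of the last interval, hence A₂ ≥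
    -- β c A₁ / 2.
    rcases le_total A₁ A₂ with h2 | h2
    · have h3 : c' * A ≤ α / 2 * A := mul_le_mul_of_nonneg_right hc1 hA
      have h4 : α * A ≤ α * (2 * A₂) := mul_le_mul_of_nonneg_left (by linarith) hα.le
      linarith
    · have hmid : τ / 2 * (β / τ * (c * A₁)) ≤ A₂ := by
        have h3 : ∫ r in Ioc (t - τ) (t - τ / 2), β / τ * (c * A₁)
            ≤ ∫ r in Ioc (t - τ) (t - τ / 2), F r := by
          refine setIntegral_mono_on (integrableOn_const measure_Ioc_lt_top.ne)
            (hint _ _ (by linarith) (by linarith)) measurableSet_Ioc fun r hr => ?_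
          have hr1 : T < r := by linarith [hr.1]
          have hr2 : r ≤ T₂ := by linarith [hr.2]
          refine hPF r _ ⟨hr1, hr2⟩ (by positivity) (hPm r _ _ ?_
            (ih F P τ T T₂ hτ hF hF0 hPm hP hPF r hr1.le hr2 ?_))
          · refine mul_le_mul_of_nonneg_left ?_ hc.le
            refine setIntegral_mono_set (hint _ _ le_rfl hr2) ?_
              (Ioc_subset_Ioc_right hr.1.le).eventuallyLE
            exact ae_restrict_of_forall_mem measurableSet_Ioc
              fun q hq => hF0 q ⟨hq.1, hq.2.trans hr2⟩
          · push_cast at htn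
            linarith [hr.2]
        have h4 : ∫ r in Ioc (t - τ) (t - τ / 2), F r ≤ A₂ := by
          refine setIntegral_mono_set (hint _ _ (by linarith) ht') ?_
            (Ioc_subset_Ioc_right (by linarith)).eventuallyLE
          exact ae_restrict_of_forall_mem measurableSet_Ioc
            fun q hq => hF0 q ⟨by linarith [hq.1], hq.2.trans ht'⟩
        rw [setIntegral_const, measureReal_def, Real.volume_Ioc, smul_eq_mul,
          ENNReal.toReal_ofReal (by linarith)] at h3
        calc _ = (t - τ / 2 - (t - τ)) * (β / τ * (c * A₁)) := by ring
          _ ≤ A₂ := h3.trans h4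
      have h5 : τ / 2 * (β / τ * (c * A₁)) = β * c * A₁ / 2 := by field_simp
      rw [h5] at hmid
      have h6 : c' * A ≤ α * β * c / 4 * A := mul_le_mul_of_nonneg_right hc2 hA
      have h7 : α * β * c / 4 * A ≤ α * β * c / 4 * (2 * A₁) :=
        mul_le_mul_of_nonneg_left (by linarith) (by positivity)
      have h8 := mul_le_mul_of_nonneg_left hmid hα.le
      linarith

/-- The weak Harnack inequality for nonnegative supersolutions with zero right-hand side. -/
lemma exists_harnack_bound (hd : 1 ≤ d) (hs0 : 0 < s) (hs1 : s < 1) (hlam : 0 < lam)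
    (hLam : 0 < Lam) :
    ∃ c : ℝ, 0 < c ∧ ∀ (ρ R : ℝ), 0 ≤ ρ → ρ < R → ∀ u : Space d → ℝ → ℝ,
      (∀ x, ∀ t ∈ timeInterval s R, 0 ≤ u x t) →
      IsViscositySupersolution (pucciInf s lam Lam ρ) (fun _ _ => 0)
        (Metric.ball 0 R) (timeInterval s R) u →
      ∀ T t : ℝ, -(R ^ (2 * s)) < T → T ≤ t → t ≤ 0 → ∀ x : Space d, ‖x‖ < R / 2 →
      c * ∫ r in Ioc T t, tailMass s R (fun x => u x r) ≤ u x t := by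
  obtain ⟨C, hC, hshort⟩ := exists_short_time_bound (lam := lam) hd hs0 hs1 hlam hLam
  -- With τ = R^{2s}/(2C), the largest length allowed by the short-time bound, the whole interval
  -- has length R^{2s} = 4C · τ/2. So 4C steps suffice, independently of R. The choice of β below
  -- makes β/τ equal to `innerMass` times R^{-2s}.
  obtain ⟨n, hn⟩ := exists_nat_ge (4 * C)
  have hω := innerMass_pos d s
  obtain ⟨c, hc, hlong⟩ := exists_long_time_bound (α := lam / 2) (β := innerMass d s / (2 * C))
    (by positivity) (by positivity) n
  refine ⟨c, hc, fun ρ R hρ hρR u hu0 hu T t hT hTt ht x hx => ?_⟩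
  have hR : 0 < R := hρ.trans_lt hρR
  have hq : R ^ (-(2 * s)) * R ^ (2 * s) = 1 := by
    rw [← Real.rpow_add hR, neg_add_cancel, Real.rpow_zero]
  have hRs : 0 < R ^ (2 * s) := by positivity
  have hsub : Ioc T 0 ⊆ timeInterval s R := Ioc_subset_Ioc_left hT.le
  refine hlong (fun r => tailMass s R fun x => u x r)
    (fun t h => ∀ x : Space d, ‖x‖ < R / 2 → h ≤ u x t) (R ^ (2 * s) / (2 * C)) T 0
    (by positivity) ((integrableOn_tailMass hs0 hR hu.bounded).mono_set hsub)
    (fun r hr => tailMass_nonneg hR fun x => hu0 x r (hsub hr))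
    (fun t h h' hh hp x hx => hh.trans (hp x hx)) ?_ ?_ t hTt ht ?_ x hx
  · intro r r' hr hrr hr' hτ
    refine hshort ρ R hρ hρR u hu0 hu r r' (by linarith) hrr hr' ?_
    calc C * R ^ (-(2 * s)) * (r' - r) ≤ C * R ^ (-(2 * s)) * (R ^ (2 * s) / (2 * C)) := by gcongr
      _ = R ^ (-(2 * s)) * R ^ (2 * s) * (1 / 2) := by field_simp
      _ = 1 / 2 := by rw [hq, one_mul]
  · intro r h hr hh hp
    refine le_trans (le_of_eq ?_) (innerMass_mul_le hs0 hR hh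
      (integrable_mul_tailWeight hs0 hR (hu.bounded.memLp_slice r (hsub hr)))
      (fun x => hu0 x r (hsub hr)) hp)
    rw [Real.rpow_neg hR.le]
    field_simp
  · calc t - T ≤ R ^ (2 * s) := by linarith
      _ = 4 * C * (R ^ (2 * s) / (2 * C) / 2) := by field_simp; norm_num
      _ ≤ _ := by gcongr

end NonlocalParabolic

open NonlocalParabolic
-- Conclusion
theorem mainTheorem3 (d : ℕ) (hd : 1 ≤ d) (s : ℝ) (hs0 : 0 < s) (hs1 : s < 1)
    (lam Lam : ℝ) (hlam : 0 < lam) (hLam : 0 < Lam) :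
    ∃ c : ℝ, 0 < c ∧
      ∀ (ρ R a : ℝ), 0 ≤ ρ → ρ < R → 0 ≤ a →
      ∀ u : Space d → ℝ → ℝ,
        (∀ x : Space d, ∀ t ∈ closure (timeInterval s R), 0 ≤ u x t) →
        IsViscositySupersolution (pucciInf s lam Lam ρ) (fun _ _ => -(R ^ (-(2 * s)) * a))
          (Metric.ball 0 R) (timeInterval s R) u →
        c * (∫ t in timeInterval s R \ timeInterval s (R / 2),
              ∫ x : Space d, u x t / (R + ‖x‖) ^ ((d : ℝ) + 2 * s)) - a
          ≤ sInf ((fun p : Space d × ℝ => u p.1 p.2) '' parabolicCylinder d s (R / 2)) := by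
  obtain ⟨c, hc, hmain⟩ := exists_harnack_bound (lam := lam) hd hs0 hs1 hlam hLam
  refine ⟨c, hc, fun ρ R a hρ hρR ha u hu0 hu => ?_⟩
  have hR : 0 < R := hρ.trans_lt hρR
  have hRs : 0 < R ^ (2 * s) := by positivity
  have hq : R ^ (-(2 * s)) * R ^ (2 * s) = 1 := by
    rw [← Real.rpow_add hR, neg_add_cancel, Real.rpow_zero]
  have hu0' : ∀ x, ∀ t ∈ timeInterval s R, 0 ≤ u x t := fun x t ht => hu0 x t (subset_closure ht)
  refine le_csInf (Set.Nonempty.image _ ⟨(0, 0), ?_⟩) ?_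
  · refine ⟨by simpa using hR, ?_, le_rfl⟩
    have : 0 < (R / 2) ^ (2 * s) := by positivity
    linarith
  rintro _ ⟨⟨x, t⟩, ⟨hx, ht⟩, rfl⟩
  replace hx : ‖x‖ < R / 2 := by simpa using hx
  change c * _ - a ≤ u x t
  have hhalf : (R / 2) ^ (2 * s) ≤ R ^ (2 * s) := by gcongr; linarith
  have htR : t ∈ timeInterval s R := ⟨by linarith [ht.1], ht.2⟩
  set κ := R ^ (-(2 * s)) * a with hκ
  have hκ0 : 0 ≤ κ := by positivity
  -- The added term vanishes at t = -R^{2s} and equals a at t = 0, so u ≤ u' ≤ u + a on the whole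
  -- time interval.
  set u' : Space d → ℝ → ℝ := fun x t => u x t + κ * (t + R ^ (2 * s)) with hu'
  have huu' : ∀ x, ∀ t ∈ timeInterval s R, u x t ≤ u' x t := fun x t ht => by
    have := mul_nonneg hκ0 (by linarith [ht.1] : 0 ≤ t + R ^ (2 * s))
    simp only [hu']; linarith
  have hsup := hu.add_linear (T₀ := R ^ (2 * s))
  have hu'0 : ∀ x, ∀ t ∈ timeInterval s R, 0 ≤ u' x t :=
    fun x t ht => (hu0' x t ht).trans (huu' x t ht)
  have hF'int := integrableOn_tailMass hs0 hR hsup.bounded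
  have hF'0 : ∀ r ∈ timeInterval s R, 0 ≤ tailMass s R fun x => u' x r :=
    fun r hr => tailMass_nonneg hR fun x => hu'0 x r hr
  -- The barrier argument needs a compact time interval inside I_R, hence a starting time T >
  -- -R^{2s}. The endpoint is reached by continuity of the integral in T.
  have hlim : c * ∫ r in Ioc (-(R ^ (2 * s))) t, tailMass s R (fun x => u' x r) ≤ u' x t := by
    have hii : IntervalIntegrable (fun r => tailMass s R fun x => u' x r) volume
        (-(R ^ (2 * s))) t :=
      (intervalIntegrable_iff_integrableOn_Ioc_of_le htR.1.le).2
        (hF'int.mono_set (Ioc_subset_Ioc_right ht.2))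
    have hcont := intervalIntegral.continuousOn_primitive_interval_left
      (f := fun r => tailMass s R fun x => u' x r) (μ := volume) (a := -(R ^ (2 * s))) (b := t)
      (by
        rw [uIcc_of_le htR.1.le, integrableOn_Icc_iff_integrableOn_Ioc]
        exact hF'int.mono_set (Ioc_subset_Ioc_right ht.2))
    rw [uIcc_of_le htR.1.le] at hcont
    have h1 := (hcont _ (left_mem_Icc.2 htR.1.le)).mono Ioo_subset_Icc_self
    have h2 : Filter.Tendsto (fun T => c * ∫ r in T..t, tailMass s R (fun x => u' x r))
        (nhdsWithin (-(R ^ (2 * s))) (Ioo (-(R ^ (2 * s))) t))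
        (nhds (c * ∫ r in (-(R ^ (2 * s)))..t, tailMass s R (fun x => u' x r))) :=
      h1.tendsto.const_mul c
    rw [← intervalIntegral.integral_of_le htR.1.le]
    have : (nhdsWithin (-(R ^ (2 * s))) (Ioo (-(R ^ (2 * s))) t)).NeBot := by
      rw [nhdsWithin_Ioo_eq_nhdsGT htR.1]; infer_instance
    refine le_of_tendsto h2 (eventually_nhdsWithin_of_forall fun T hT => ?_)
    rw [intervalIntegral.integral_of_le hT.2.le]
    exact hmain ρ R hρ hρR u' hu'0 hsup T t hT.1 hT.2.le ht.2 x hx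
  -- Every time in I_R \ I_{R/2} precedes every t in I_{R/2}, so one lower bound serves all of
  -- Q_{R/2}.
  have hset : timeInterval s R \ timeInterval s (R / 2) ⊆ Ioc (-(R ^ (2 * s))) t := by
    rintro r ⟨hr, hr'⟩
    refine ⟨hr.1, ?_⟩
    by_contra! h
    exact hr' ⟨ht.1.trans h, hr.2⟩
  have hle : ∫ r in timeInterval s R \ timeInterval s (R / 2),
      ∫ x : Space d, u x r / (R + ‖x‖) ^ ((d : ℝ) + 2 * s)
      ≤ ∫ r in Ioc (-(R ^ (2 * s))) t, tailMass s R (fun x => u' x r) := by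
    calc _ ≤ ∫ r in timeInterval s R \ timeInterval s (R / 2),
          tailMass s R (fun x => u' x r) := by
          refine setIntegral_mono_on ?_ (hF'int.mono_set sdiff_subset)
            ((measurableSet_timeInterval s R).diff (measurableSet_timeInterval s _)) ?_
          · exact (integrableOn_tailMass hs0 hR hu.bounded).mono_set sdiff_subset
          · intro r hr
            refine integral_mono
              (integrable_mul_tailWeight hs0 hR (hu.bounded.memLp_slice r hr.1))
              (integrable_mul_tailWeight hs0 hR (hsup.bounded.memLp_slice r hr.1))
              fun z => ?_
            exact mul_le_mul_of_nonneg_right (huu' z r hr.1) (tailWeight_pos hR z).le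
      _ ≤ _ := by
          refine setIntegral_mono_set (hF'int.mono_set (Ioc_subset_Ioc_right ht.2)) ?_
            hset.eventuallyLE
          exact ae_restrict_of_forall_mem measurableSet_Ioc
            fun r hr => hF'0 r ⟨hr.1, hr.2.trans ht.2⟩
  have h1 := mul_le_mul_of_nonneg_left hle hc.le
  have h2 : u' x t ≤ u x t + a := by
    have h3 : κ * (t + R ^ (2 * s)) ≤ κ * R ^ (2 * s) :=
      mul_le_mul_of_nonneg_left (by linarith [ht.2]) hκ0
    have h4 : κ * R ^ (2 * s) = a := by
      rw [hκ]; linear_combination a * hq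
    simp only [hu']; linarith
  linarith
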